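/- **Setting.** Let $n\ge 1$. The Heisenberg group $\mathbb H^n=\mathbb R^{n}\times\mathbb R^n\times\mathbb R$ has coordinates $p=(x,y,t)$, unit $e=0$, product $p\cdot p'=(x+x',y+y',t+t'+\frac12\sum_j(x_jy_j'-y_jx_j'))$, contact form $\theta^{\mathbb H}=dt-\frac12\sum_j(x_jdy_j-y_jdx_j)$, left-invariant horizontal frame $W^{\mathbb H}_j=X_j=\partial_{x_j}-\frac12y_j\partial_t$, $W^{\mathbb H}_{n+j}=Y_j=\partial_{y_j}+\frac12x_j\partial_t$ $(1\le j\le n)$, Reeb field $\xi^{\mathbb H}=T=\partial_t$, and the left-invariant metric for which $X_j,Y_j,T$ are orthonormal. Let $d_0$ and $d$ each be either the Korányi distance $\varrho(p^{-1}\cdot q)$, $\varrho(x,y,t)=((|x|^2+|y|^2)^2+16t^2)^{1/4}$, or the Carnot–Carathéodory (sub-Riemannian) distance of $\mathbb H^n$, and let $B(e,s)$ be the $d_0$-ball. A smooth sub-Riemannian contact manifold $(M,H,g^M)$ is a connected smooth manifold without boundary of dimension $2n+1$ with a smooth 1-form $\theta^M$ such that $H=\ker\theta^M$ is a hyperplane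 distribution and $d\theta^M|_H$ is non-degenerate, a smooth endomorphism $J$ of $TM$ preserving $H$ with $J^2=-1$, $d\theta^M(u,Jv)=-d\theta^M(Ju,v)$, $d\theta^M(u,Ju)>0$ for $0\ne u\in H$ (and $u,v\in H$), and $J\xi^M=\xi^M$, where $\xi^M$ is the Reeb field ($\theta^M(\xi^M)=1$, $d\theta^M(\xi^M,\cdot)=0$), and the metric $g^M(u,v)=\theta^M(u)\theta^M(v)+d\theta^M(u,Jv)$. Here $d\theta(U,V)=U\theta(V)-V\theta(U)-\theta([U,V])$. Let $d_M$ be its sub-Riemannian distance and $B(a,r)$ its balls. An orthonormal symplectic basis of $\ker\theta^M_a$ is an orthonormal basis $(W_1,\dots,W_{2n})$ with $W_{n+j}=-JW_j$ for $1\le j\le n$ (as for $X_1,\dots,X_n,Y_1,\dots,Y_n$ in $\mathbb H^n$). For $k\in\mathbb N$ and $R,r,C>0$, a *bounded contact atlas* with constants $(R,r,C)$ is a family of diffeomorphisms $\phi_a$, $a\in M$, from $B(e,R)\subset\mathbb H^n$ onto open subsets of $M$ with $\phi_a^\sharp\theta^M=\theta^{\mathbb H}$ such that, for all $a,b\in M$: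 (1) $B(a,r)\subset\phi_a(B(e,R))$; (2) $\frac1C d(p,q)\le d_M(\phi_a(p),\phi_a(q))\le C\,d(p,q)$ for all $p,q\in B(e,R)$; (3) the coordinate change $\phi_b^{-1}\circ\phi_a$ (as an $\mathbb R^{2n+1}$-valued map, where it is defined) and its derivatives $V_1\cdots V_m(\phi_b^{-1}\circ\phi_a)$, $m\le k$, with respect to unit left-invariant horizontal vector fields $V_i$ are bounded by $C$ in Euclidean norm. **Theorem 3.10.** Given $n\ge1$, $k\in\mathbb N$, $d_0$, $d$ and $r,C_M>0$, there are constants $0<r'<r$, $0<\mu\le1$ and $C'>0$, depending only on these data, with the following property. Let $(M,H,g^M)$ be a smooth sub-Riemannian contact manifold of dimension $2n+1$, complete for $d_M$, with bounded $C^k$-geometry with constants $r,C_M$, i.e. having a bounded contact atlas with constants $(1,r,C_M)$. For every $a\in M$ let $\{W^M_{1,a},\dots,W^M_{2n,a}\}$ be an orthonormal symplectic basis of $\ker\theta^M_a$. Then there are contact maps $\psi_a:B(e,\mu)\to M$, $a\in M$, which form a bounded contact atlas with constants $(\mu,r',C')$ (in particular $B(a,r')\subset\psi_a(B(e,\mu))$),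 such that for every $a\in M$: (i) $\psi_a(e)=a$; (ii) $(d\psi_a)_eW^{\mathbb H}_{j,e}=W^M_{j,a}$ for $j=1,\dots,2n$, and $(d\psi_a)_e\xi^{\mathbb H}_e=\xi^M_a$; in particular $(d\psi_a)_e:T_e\mathbb H^n\to T_aM$ is an orthogonal linear map, i.e. a linear bijection preserving the scalar products. -/

import Mathlib

open Set MeasureTheory
open scoped Manifold ContDiff ENNReal Topology

noncomputable section

-- Prefer the standard charted space structure of a model space on itself in instance searches.
attribute [instance 2000] chartedSpaceSelf

/-! ### One-forms and sub-Riemannian distances on manifolds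

`M` is a manifold without boundary modelled on the normed space `E`. -/

section General

variable {E : Type*} [NormedAddCommGroup E] [NormedSpace ℝ E]
  {M : Type*} [TopologicalSpace M] [ChartedSpace E M]

/-- The one-form `θ` read in the preferred chart at `x`, i.e. its pullback to (an open subset of)
the model space `E` by the inverse of that chart. -/
def formInChart (θ : ∀ x : M, TangentSpace 𝓘(ℝ, E) x →L[ℝ] ℝ) (x : M) (z : E) : E →L[ℝ] ℝ :=
  (θ ((extChartAt 𝓘(ℝ, E) x).symm z)).comp
    (mfderiv 𝓘(ℝ, E) 𝓘(ℝ, E) (extChartAt 𝓘(ℝ, E) x).symm z)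

/-- The exterior derivative `dθ_x(u, v)` of a one-form: computed in the preferred chart at `x`, where
`dω_z(u, v) = (D_u ω)_z(v) - (D_v ω)_z(u)`, that is, with the convention
`dθ(U, V) = U(θ(V)) - V(θ(U)) - θ([U, V])`. -/
def formD (θ : ∀ x : M, TangentSpace 𝓘(ℝ, E) x →L[ℝ] ℝ) (x : M)
    (u v : TangentSpace 𝓘(ℝ, E) x) : ℝ :=
  let c : TangentSpace 𝓘(ℝ, E) x → E := fun w =>
    mfderiv 𝓘(ℝ, E) 𝓘(ℝ, E) (extChartAt 𝓘(ℝ, E) x) x w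
  let Dω : E →L[ℝ] E →L[ℝ] ℝ := fderiv ℝ (formInChart θ x) (extChartAt 𝓘(ℝ, E) x x)
  Dω (c u) (c v) - Dω (c v) (c u)

/-- The velocity at time `t` of a curve defined on `[0, 1]`. -/
def curveVelocity (γ : ℝ → M) (t : ℝ) : TangentSpace 𝓘(ℝ, E) (γ t) :=
  mfderivWithin 𝓘(ℝ, ℝ) 𝓘(ℝ, E) γ (Icc 0 1) t (1 : ℝ)

/-- `γ : [0, 1] → M` is a `C¹` horizontal curve (i.e. tangent to `ker θ`). -/
def IsHorizontalCurve (θ : ∀ x : M, TangentSpace 𝓘(ℝ, E) x →L[ℝ] ℝ) (γ : ℝ → M) : Prop :=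
  ContMDiffOn 𝓘(ℝ, ℝ) 𝓘(ℝ, E) 1 γ (Icc 0 1) ∧
    ∀ t ∈ Icc (0 : ℝ) 1, θ (γ t) (curveVelocity γ t) = 0

/-- The length of a curve `γ : [0, 1] → M` with respect to a field `g` of quadratic forms. -/
def curveLength (g : ∀ x : M, TangentSpace 𝓘(ℝ, E) x → TangentSpace 𝓘(ℝ, E) x → ℝ)
    (γ : ℝ → M) : ℝ≥0∞ :=
  ∫⁻ t in Icc (0 : ℝ) 1, ENNReal.ofReal
    (Real.sqrt (g (γ t) (curveVelocity γ t) (curveVelocity γ t)))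

/-- `HorizontalPath θ g x y ℓ`: there is a piecewise `C¹` horizontal curve of length `ℓ` from `x`
to `y` (a finite concatenation of `C¹` horizontal curves, each one parametrized by `[0, 1]`). -/
inductive HorizontalPath (θ : ∀ x : M, TangentSpace 𝓘(ℝ, E) x →L[ℝ] ℝ)
    (g : ∀ x : M, TangentSpace 𝓘(ℝ, E) x → TangentSpace 𝓘(ℝ, E) x → ℝ) :
    M → M → ℝ≥0∞ → Prop
  | refl (x : M) : HorizontalPath θ g x x 0
  | step {x : M} {ℓ : ℝ≥0∞} (γ : ℝ → M) (h : HorizontalPath θ g x (γ 0) ℓ)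
      (hγ : IsHorizontalCurve θ γ) : HorizontalPath θ g x (γ 1) (ℓ + curveLength g γ)

/-- The sub-Riemannian (Carnot-Carathéodory) distance: the infimum of the lengths of the piecewise
`C¹` horizontal curves from `x` to `y` (`∞` if there is none). -/
def subRiemannianDist (θ : ∀ x : M, TangentSpace 𝓘(ℝ, E) x →L[ℝ] ℝ)
    (g : ∀ x : M, TangentSpace 𝓘(ℝ, E) x → TangentSpace 𝓘(ℝ, E) x → ℝ) (x y : M) : ℝ≥0∞ :=
  sInf {ℓ | HorizontalPath θ g x y ℓ}

end General

/-! ### The Heisenberg group -/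

/-- The Heisenberg group `ℍⁿ`, identified with `ℝ²ⁿ⁺¹ = ℝⁿ × ℝⁿ × ℝ` through exponential
coordinates `(x, y, t)`. Only the vector space and the smooth structure of the product are used (not
its sup norm, nor its addition as a group law); the unit element `e` is `0`. -/
abbrev Heis (n : ℕ) : Type :=
  EuclideanSpace ℝ (Fin n) × EuclideanSpace ℝ (Fin n) × ℝ

namespace Heis

variable {n : ℕ}

/-- The group law `p · q = (x + x', y + y', t + t' + ½ ∑ (x_j y'_j - y_j x'_j))`. -/
def mul (p q : Heis n) : Heis n :=
  (p.1 + q.1, p.2.1 + q.2.1,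
    p.2.2 + q.2.2 + (1 / 2) * (inner ℝ p.1 q.2.1 - inner ℝ p.2.1 q.1))

/-- The inverse `p⁻¹ = -p`. -/
def inv (p : Heis n) : Heis n := -p

/-- The left-invariant horizontal vector field `∑ (a_j X_j + b_j Y_j)`, where
`X_j = ∂_{x_j} - ½ y_j ∂_t` and `Y_j = ∂_{y_j} + ½ x_j ∂_t`. -/
def horizontalField (w : EuclideanSpace ℝ (Fin n) × EuclideanSpace ℝ (Fin n)) (p : Heis n) :
    Heis n :=
  (w.1, w.2, (1 / 2) * (inner ℝ p.1 w.2 - inner ℝ p.2.1 w.1))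

/-- The standard horizontal frame: `X_1, …, X_n` (indices `Sum.inl j`) and `Y_1, …, Y_n` (indices
`Sum.inr j`). -/
def frame (j : Fin n ⊕ Fin n) (p : Heis n) : Heis n :=
  match j with
  | Sum.inl i => horizontalField (EuclideanSpace.single i 1, 0) p
  | Sum.inr i => horizontalField (0, EuclideanSpace.single i 1) p

/-- The vector field `T = ∂_t`, which is the Reeb vector field of `θ^ℍ`. -/
def reeb (_p : Heis n) : Heis n := (0, 0, 1)

/-- The contact form `θ^ℍ = dt - ½ ∑ (x_j dy_j - y_j dx_j)`. -/
def contactForm (p : Heis n) : Heis n →L[ℝ] ℝ :=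
  (ContinuousLinearMap.snd ℝ (EuclideanSpace ℝ (Fin n)) ℝ).comp
      (ContinuousLinearMap.snd ℝ (EuclideanSpace ℝ (Fin n)) (EuclideanSpace ℝ (Fin n) × ℝ)) -
    (1 / 2 : ℝ) •
      ((innerSL ℝ p.1).comp
          ((ContinuousLinearMap.fst ℝ (EuclideanSpace ℝ (Fin n)) ℝ).comp
            (ContinuousLinearMap.snd ℝ (EuclideanSpace ℝ (Fin n)) (EuclideanSpace ℝ (Fin n) × ℝ)))
        - (innerSL ℝ p.2.1).comp
          (ContinuousLinearMap.fst ℝ (EuclideanSpace ℝ (Fin n)) (EuclideanSpace ℝ (Fin n) × ℝ)))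

/-- The left-invariant scalar product on the tangent spaces which makes `X_1, …, X_n, Y_1, …, Y_n, T`
orthonormal: the dual coframe is `dx_1, …, dx_n, dy_1, …, dy_n, θ^ℍ`. -/
def metric (p : Heis n) (u v : Heis n) : ℝ :=
  inner ℝ u.1 v.1 + inner ℝ u.2.1 v.2.1 + contactForm p u * contactForm p v

/-- The Cygan-Korányi norm `ϱ(p) = ((|x|² + |y|²)² + 16 t²)^{1/4}`. -/
def koranyiNorm (p : Heis n) : ℝ :=
  ((‖p.1‖ ^ 2 + ‖p.2.1‖ ^ 2) ^ 2 + 16 * p.2.2 ^ 2) ^ (1 / 4 : ℝ)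

/-- The gauge (Korányi) distance `ϱ(p⁻¹ · q)`. -/
def koranyiDist (p q : Heis n) : ℝ≥0∞ := ENNReal.ofReal (koranyiNorm (mul (inv p) q))

/-- The sub-Riemannian (Carnot-Carathéodory) distance of `ℍⁿ`, for the horizontal distribution
`ker θ^ℍ` with orthonormal frame `X_1, …, X_n, Y_1, …, Y_n`. -/
def ccDist (p q : Heis n) : ℝ≥0∞ :=
  subRiemannianDist (E := Heis n) (M := Heis n) (fun p => contactForm p) (fun p => metric p) p q

/-- The two standard distances of `ℍⁿ`: the Korányi distance and the sub-Riemannian distance. -/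
def standardDistances (n : ℕ) : Set (Heis n → Heis n → ℝ≥0∞) := {koranyiDist, ccDist}

/-- The ball `B(e, s)` of centre `e = 0` and radius `s` for the distance `d`. -/
def ball (d : Heis n → Heis n → ℝ≥0∞) (s : ℝ) : Set (Heis n) :=
  {p | d 0 p < ENNReal.ofReal s}

/-- The Euclidean norm of `ℝ²ⁿ⁺¹` in the coordinates `(x, y, t)`. -/
def euclNorm (v : Heis n) : ℝ := Real.sqrt (‖v.1‖ ^ 2 + ‖v.2.1‖ ^ 2 + v.2.2 ^ 2)

/-- The iterated derivative `V_1 V_2 ⋯ V_m F` of a map `F` with values in `ℝ²ⁿ⁺¹`, along the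
left-invariant horizontal vector fields `V_i` with coefficients `w_i` (`w = [w_1, …, w_m]`). -/
def horizontalDeriv :
    List (EuclideanSpace ℝ (Fin n) × EuclideanSpace ℝ (Fin n)) →
      (Heis n → Heis n) → Heis n → Heis n
  | [], F => F
  | w :: ws, F => fun p => fderiv ℝ (horizontalDeriv ws F) p (horizontalField w p)

end Heis

/-! ### Sub-Riemannian contact manifolds -/

/-- A smooth sub-Riemannian contact structure on the manifold `M`: a smooth contact form `θ`, with
contact distribution `H = ker θ`, together with a smooth field `J` of endomorphisms of the tangent
spaces which preserves `H`, satisfies `J² = -1`, `dθ(u, J v) = -dθ(J u, v)` and `dθ(u, J u) > 0` on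
`H`, and fixes the Reeb vector field. -/
structure ContactSubRiemannian {E : Type*} [NormedAddCommGroup E] [NormedSpace ℝ E]
    (M : Type*) [TopologicalSpace M] [ChartedSpace E M] [IsManifold 𝓘(ℝ, E) ∞ M] where
  θ : ∀ x : M, TangentSpace 𝓘(ℝ, E) x →L[ℝ] ℝ
  θ_smooth : ContMDiff 𝓘(ℝ, E) (𝓘(ℝ, E).prod 𝓘(ℝ, E →L[ℝ] ℝ)) ∞
    (fun x => Bundle.TotalSpace.mk' (E →L[ℝ] ℝ)
      (E := fun x : M => TangentSpace 𝓘(ℝ, E) x →L[ℝ] Bundle.Trivial M ℝ x) x (θ x))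
  θ_ne_zero : ∀ x, θ x ≠ 0
  nondegenerate : ∀ x (u : TangentSpace 𝓘(ℝ, E) x), θ x u = 0 →
    (∀ v : TangentSpace 𝓘(ℝ, E) x, θ x v = 0 → formD θ x u v = 0) → u = 0
  J : ∀ x : M, TangentSpace 𝓘(ℝ, E) x →L[ℝ] TangentSpace 𝓘(ℝ, E) x
  J_smooth : ContMDiff 𝓘(ℝ, E) (𝓘(ℝ, E).prod 𝓘(ℝ, E →L[ℝ] E)) ∞
    (fun x => Bundle.TotalSpace.mk' (E →L[ℝ] E)
      (E := fun x : M => TangentSpace 𝓘(ℝ, E) x →L[ℝ] TangentSpace 𝓘(ℝ, E) x) x (J x))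
  J_horizontal : ∀ x (u : TangentSpace 𝓘(ℝ, E) x), θ x u = 0 → θ x (J x u) = 0
  J_sq : ∀ x (u : TangentSpace 𝓘(ℝ, E) x), θ x u = 0 → J x (J x u) = -u
  J_skew : ∀ x (u v : TangentSpace 𝓘(ℝ, E) x), θ x u = 0 → θ x v = 0 →
    formD θ x u (J x v) = -formD θ x (J x u) v
  J_pos : ∀ x (u : TangentSpace 𝓘(ℝ, E) x), θ x u = 0 → u ≠ 0 → 0 < formD θ x u (J x u)
  J_reeb : ∀ x (ξ : TangentSpace 𝓘(ℝ, E) x), θ x ξ = 1 → (∀ v, formD θ x ξ v = 0) → J x ξ = ξ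

namespace ContactSubRiemannian

variable {E : Type*} [NormedAddCommGroup E] [NormedSpace ℝ E]
  {M : Type*} [TopologicalSpace M] [ChartedSpace E M] [IsManifold 𝓘(ℝ, E) ∞ M]
  (S : ContactSubRiemannian (E := E) M)

/-- The metric `g^M(u, v) = θ(u) θ(v) + dθ(u, J v)`. -/
def metric (x : M) (u v : TangentSpace 𝓘(ℝ, E) x) : ℝ :=
  S.θ x u * S.θ x v + formD S.θ x u (S.J x v)

/-- The sub-Riemannian distance `d_M` of `(M, H, g^M)`. -/
def subDist (x y : M) : ℝ≥0∞ := subRiemannianDist S.θ S.metric x y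

/-- Completeness of the sub-Riemannian distance: every Cauchy sequence converges. -/
def IsMetricComplete : Prop :=
  ∀ u : ℕ → M,
    (∀ ε : ℝ≥0∞, 0 < ε → ∃ N, ∀ i ≥ N, ∀ j ≥ N, S.subDist (u i) (u j) < ε) →
    ∃ x, Filter.Tendsto (fun i => S.subDist (u i) x) Filter.atTop (𝓝 0)

/-- `ξ` is the (value at `x` of the) Reeb vector field: `θ(ξ) = 1` and `dθ(ξ, ·) = 0`. -/
def IsReebVector (x : M) (ξ : TangentSpace 𝓘(ℝ, E) x) : Prop :=
  S.θ x ξ = 1 ∧ ∀ v, formD S.θ x ξ v = 0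

/-- `W` is an orthonormal symplectic basis of `ker θ_x`: an orthonormal basis of `ker θ_x` of the form
`Z_1, …, Z_n, -J Z_1, …, -J Z_n`. The minus sign is the one of the standard frame
`X_1, …, X_n, Y_1, …, Y_n` of `ℍⁿ`: there `dθ^ℍ(X_j, Y_j) = -θ^ℍ([X_j, Y_j]) = -1`, so that the
endomorphism `J` with `dθ^ℍ(X_j, J X_j) = 1` satisfies `J X_j = -Y_j`. -/
structure IsOrthonormalSymplecticBasis {n : ℕ} (x : M)
    (W : Fin n ⊕ Fin n → TangentSpace 𝓘(ℝ, E) x) : Prop where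
  horizontal : ∀ i, S.θ x (W i) = 0
  orthonormal : ∀ i j, S.metric x (W i) (W j) = if i = j then 1 else 0
  symplectic : ∀ i : Fin n, W (Sum.inr i) = -S.J x (W (Sum.inl i))
  span_eq : ∀ u, S.θ x u = 0 → u ∈ Submodule.span ℝ (range W)

/-- The conditions of bounded `C^k` geometry, with constants `r` and `C`, for a family of contact
charts `φ_a : B(e, R) → M`, `a ∈ M`. Balls in `ℍⁿ` are taken for the distance `d₀`, and `d` is the
distance of `ℍⁿ` in the bi-Lipschitz condition. -/
structure IsBoundedAtlas {n : ℕ} (d₀ d : Heis n → Heis n → ℝ≥0∞) (k : ℕ) (R r C : ℝ)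
    (φ : M → PartialDiffeomorph 𝓘(ℝ, Heis n) 𝓘(ℝ, E) (Heis n) M ∞) : Prop where
  /-- `φ_a` is a diffeomorphism from `B(e, R)` onto an open subset of `M`. -/
  source_eq : ∀ a, (φ a).source = Heis.ball d₀ R
  /-- `φ_a` preserves the contact forms: `φ_a^♯ θ^M = θ^ℍ`. -/
  contact : ∀ a, ∀ p ∈ Heis.ball d₀ R, ∀ v : Heis n,
    S.θ (φ a p) (mfderiv 𝓘(ℝ, Heis n) 𝓘(ℝ, E) (φ a) p v) = Heis.contactForm p v
  /-- `B(a, r) ⊂ φ_a(B(e, R))`. -/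
  ball_subset : ∀ a, {b | S.subDist a b < ENNReal.ofReal r} ⊆ φ a '' Heis.ball d₀ R
  /-- `φ_a` is `C`-bi-Lipschitz. -/
  bilipschitz : ∀ a, ∀ p ∈ Heis.ball d₀ R, ∀ q ∈ Heis.ball d₀ R,
    (ENNReal.ofReal C)⁻¹ * d p q ≤ S.subDist (φ a p) (φ a q) ∧
      S.subDist (φ a p) (φ a q) ≤ ENNReal.ofReal C * d p q
  /-- The coordinate changes `φ_b⁻¹ ∘ φ_a` and their derivatives up to order `k` with respect to unit
  left-invariant horizontal vector fields are bounded by `C`. -/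
  deriv_bound : ∀ a b, ∀ w : List (EuclideanSpace ℝ (Fin n) × EuclideanSpace ℝ (Fin n)),
    w.length ≤ k → (∀ v ∈ w, ‖v.1‖ ^ 2 + ‖v.2‖ ^ 2 = 1) →
    ∀ p ∈ Heis.ball d₀ R, φ a p ∈ (φ b).target →
      Heis.euclNorm (Heis.horizontalDeriv w (fun q => (φ b).symm (φ a q)) p) ≤ C

/-- The differential at `e` of a map `ψ : ℍⁿ → M` with `ψ(e) = a`, as a linear map from `T_e ℍⁿ` to
`T_a M`. -/
def differentialAtUnit {n : ℕ} (ψ : Heis n → M) (a : M) (h : ψ 0 = a) :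
    Heis n →L[ℝ] TangentSpace 𝓘(ℝ, E) a :=
  h ▸ mfderiv 𝓘(ℝ, Heis n) 𝓘(ℝ, E) ψ 0

/-- The linear map `D : T_e ℍⁿ → T_x M` is orthogonal: a bijection preserving the scalar products. -/
def IsOrthogonalMap {n : ℕ} (x : M) (D : Heis n →L[ℝ] TangentSpace 𝓘(ℝ, E) x) : Prop :=
  Function.Bijective D ∧ ∀ u v : Heis n, S.metric x (D u) (D v) = Heis.metric 0 u v

end ContactSubRiemannian

end

/-! The new charts are `ψ_a(x) = φ_a(p_a · L_a x)`, where `φ_a(p_a) = a` and `L_a` is a linear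
symplectic automorphism of the Heisenberg group. Left translations and such `L` preserve `θ^ℍ`, so
`ψ_a` is again a contact chart. What has to be proved is that `L_a` can be chosen to match the given
basis and that everything is uniform in `a`.

Choice of `L_a`: contact charts carry `dθ^M` to `dθ^ℍ` (`IsContact.formD_eq`). Hence the basis of
`ker θ_a`, pulled back by `φ_a` and translated to `e`, is a symplectic basis of the horizontal
space, which is the image of the standard frame under a unique linear automorphism fixing `T`
(`exists_isSymplectic`). At `e` the endomorphism `J` then becomes the standard one, so the
differential is orthogonal.

Uniform bounds: the lower Lipschitz estimate for `φ_a`, applied to short horizontal segments, bounds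
the pulled-back unit vectors (`hnorm_le_of_gaugeDist_le`), hence `L_a`. The inverse is bounded by
symplectic duality (`hnorm_symm_le`).

Uniform domain: `p_a` might lie near the boundary of the domain of `φ_a`. Completeness excludes
this: a path leaving the domain too early would have an image converging to a point of `B(a, r)`,
which the chart already covers (`mem_of_gaugeDist_lt`).

Derivatives: affine contact automorphisms map left-invariant horizontal fields to such fields, so
the coordinate changes of the `ψ_a` inherit bounds from those of the `φ_a`. Both admissible
distances are handled at once by comparing them with one homogeneous left-invariant gauge. -/

noncomputable section

/-! ### Algebra of the Heisenberg group and the gauge distance. -/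

namespace Heis

variable {n : ℕ}

/-- The standard symplectic product of the horizontal parts. -/
def symp (u v : Heis n) : ℝ := inner ℝ u.1 v.2.1 - inner ℝ u.2.1 v.1

/-- The sup norm of the horizontal part. -/
def hnorm (u : Heis n) : ℝ := max ‖u.1‖ ‖u.2.1‖

/-- A homogeneous gauge, equivalent to the Korányi norm. -/
def gauge (p : Heis n) : ℝ := max (hnorm p) (Real.sqrt |p.2.2|)

/-- The left-invariant gauge distance. -/
def gaugeDist (p q : Heis n) : ℝ := gauge (mul (inv p) q)

lemma contactForm_apply (p v : Heis n) : contactForm p v = v.2.2 - (1 / 2) * symp p v := by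
  simp [contactForm, symp]

lemma mul_def (p q : Heis n) :
    mul p q = (p.1 + q.1, p.2.1 + q.2.1, p.2.2 + q.2.2 + (1 / 2) * symp p q) := rfl

lemma horizontalField_def (w : EuclideanSpace ℝ (Fin n) × EuclideanSpace ℝ (Fin n)) (p : Heis n) :
    horizontalField w p = (w.1, w.2, (1 / 2) * symp p (w.1, w.2, 0)) := rfl

lemma symp_self (u : Heis n) : symp u u = 0 := by
  simp [symp, real_inner_comm]

lemma symp_comm (u v : Heis n) : symp u v = -symp v u := by
  simp [symp, real_inner_comm]

lemma symp_add_left (u v w : Heis n) : symp (u + v) w = symp u w + symp v w := by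
  simp [symp, inner_add_left]; ring

lemma symp_add_right (u v w : Heis n) : symp u (v + w) = symp u v + symp u w := by
  simp [symp, inner_add_right]; ring

lemma symp_smul_left (c : ℝ) (v w : Heis n) : symp (c • v) w = c * symp v w := by
  simp [symp, inner_smul_left]; ring

lemma symp_smul_right (c : ℝ) (v w : Heis n) : symp v (c • w) = c * symp v w := by
  simp [symp, inner_smul_right]; ring

lemma symp_neg_left (u v : Heis n) : symp (-u) v = -symp u v := by
  simp [symp]; ring

lemma symp_congr {u u' v v' : Heis n} (h1 : u.1 = u'.1) (h2 : u.2.1 = u'.2.1)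
    (h3 : v.1 = v'.1) (h4 : v.2.1 = v'.2.1) : symp u v = symp u' v' := by
  simp [symp, h1, h2, h3, h4]

lemma hnorm_nonneg (u : Heis n) : 0 ≤ hnorm u := (norm_nonneg _).trans (le_max_left _ _)

lemma hnorm_add_le (u v : Heis n) : hnorm (u + v) ≤ hnorm u + hnorm v :=
  max_le ((norm_add_le _ _).trans (add_le_add (le_max_left _ _) (le_max_left _ _)))
    ((norm_add_le _ _).trans (add_le_add (le_max_right _ _) (le_max_right _ _)))

lemma hnorm_smul (c : ℝ) (u : Heis n) : hnorm (c • u) = |c| * hnorm u := by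
  simp [hnorm, norm_smul, mul_max_of_nonneg]

lemma abs_symp_le (u v : Heis n) : |symp u v| ≤ 2 * (hnorm u * hnorm v) := by
  have h1 : |inner ℝ u.1 v.2.1| ≤ hnorm u * hnorm v :=
    (abs_real_inner_le_norm _ _).trans (mul_le_mul (le_max_left _ _) (le_max_right _ _)
      (norm_nonneg _) (hnorm_nonneg u))
  have h2 : |inner ℝ u.2.1 v.1| ≤ hnorm u * hnorm v :=
    (abs_real_inner_le_norm _ _).trans (mul_le_mul (le_max_right _ _) (le_max_left _ _)
      (norm_nonneg _) (hnorm_nonneg u))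
  have := abs_sub (inner ℝ u.1 v.2.1) (inner ℝ u.2.1 v.1)
  unfold symp
  linarith

lemma gauge_nonneg (p : Heis n) : 0 ≤ gauge p := (Real.sqrt_nonneg _).trans (le_max_right _ _)

lemma hnorm_le_gauge (p : Heis n) : hnorm p ≤ gauge p := le_max_left _ _

lemma abs_le_gauge_sq (p : Heis n) : |p.2.2| ≤ gauge p ^ 2 := by
  rw [← Real.sqrt_le_left (gauge_nonneg p)]
  exact le_max_right _ _

lemma gauge_le_of {p : Heis n} {b : ℝ} (hb : 0 ≤ b) (h1 : hnorm p ≤ b) (h2 : |p.2.2| ≤ b ^ 2) :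
    gauge p ≤ b :=
  max_le h1 ((Real.sqrt_le_left hb).2 h2)

lemma mul_assoc (p q s : Heis n) : mul (mul p q) s = mul p (mul q s) := by
  ext1
  · simp [mul_def, add_assoc]
  ext1
  · simp [mul_def, add_assoc]
  · simp only [mul, inner_add_left, inner_add_right]; ring

lemma inv_mul (p : Heis n) : mul (inv p) p = 0 := by
  simp [mul_def, inv, symp_neg_left, symp_self]

lemma mul_inv (p : Heis n) : mul p (inv p) = 0 := by
  simp [mul, inv, real_inner_comm]

lemma zero_mul (p : Heis n) : mul 0 p = p := by
  simp [mul]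

lemma mul_zero (p : Heis n) : mul p 0 = p := by
  simp [mul]

lemma inv_mul_cancel_left (p q : Heis n) : mul (inv p) (mul p q) = q := by
  rw [← mul_assoc, inv_mul, zero_mul]

lemma mul_inv_cancel_left (p q : Heis n) : mul p (mul (inv p) q) = q := by
  rw [← mul_assoc, mul_inv, zero_mul]

lemma inv_zero : inv (0 : Heis n) = 0 := neg_zero

lemma gaugeDist_zero_left (p : Heis n) : gaugeDist 0 p = gauge p := by
  rw [gaugeDist, inv_zero, zero_mul]

lemma inv_mul_mul (a p q : Heis n) : mul (inv (mul a p)) (mul a q) = mul (inv p) q := by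
  have : inv (mul a p) = mul (inv p) (inv a) := by
    simp only [inv, mul, Prod.fst_neg, Prod.snd_neg]
    ext1
    · simp [add_comm]
    ext1
    · simp [add_comm]
    · simp [real_inner_comm]; ring
  rw [this, mul_assoc, inv_mul_cancel_left]

lemma gaugeDist_mul_left (a p q : Heis n) : gaugeDist (mul a p) (mul a q) = gaugeDist p q := by
  rw [gaugeDist, inv_mul_mul, gaugeDist]

lemma gauge_zero : gauge (0 : Heis n) = 0 := by
  simp [gauge, hnorm]

lemma gaugeDist_self (p : Heis n) : gaugeDist p p = 0 := by
  rw [gaugeDist, inv_mul, gauge_zero]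

lemma eq_of_gaugeDist_eq_zero {p q : Heis n} (h : gaugeDist p q = 0) : p = q := by
  have h0 : mul (inv p) q = 0 := by
    have h1 := hnorm_le_gauge (mul (inv p) q)
    have h2 := abs_le_gauge_sq (mul (inv p) q)
    unfold gaugeDist at h
    rw [h] at h1 h2
    have a1 := (le_max_left _ _).trans h1
    have a2 := (le_max_right _ _).trans h1
    ext1
    · simpa using a1
    ext1
    · simpa using a2
    · simpa using h2
  rw [← mul_inv_cancel_left p q, h0, mul_zero]

lemma continuous_gauge : Continuous (gauge : Heis n → ℝ) := by
  unfold gauge hnorm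
  fun_prop

lemma continuous_mul : Continuous fun pq : Heis n × Heis n => mul pq.1 pq.2 := by
  unfold mul
  fun_prop

lemma continuous_gaugeDist : Continuous fun pq : Heis n × Heis n => gaugeDist pq.1 pq.2 := by
  unfold gaugeDist
  refine continuous_gauge.comp (continuous_mul.comp (f := fun pq : Heis n × Heis n => (inv pq.1, pq.2)) ?_)
  unfold inv
  fun_prop

/-! ### Comparison of the standard distances with the gauge -/

lemma gauge_le_koranyiNorm (p : Heis n) : gauge p ≤ koranyiNorm p := by
  have hk : 0 ≤ koranyiNorm p := by unfold koranyiNorm; positivity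
  have h4 : koranyiNorm p ^ 4 = (‖p.1‖ ^ 2 + ‖p.2.1‖ ^ 2) ^ 2 + 16 * p.2.2 ^ 2 := by
    unfold koranyiNorm
    rw [← Real.rpow_natCast, ← Real.rpow_mul (by positivity)]
    norm_num
  have h0 : 0 ≤ p.2.2 ^ 2 := sq_nonneg _
  refine gauge_le_of hk (max_le ?_ ?_) ?_
  · refine le_of_pow_le_pow_left₀ (n := 4) (by norm_num) hk ?_
    rw [h4]; nlinarith [sq_nonneg ‖p.2.1‖, sq_nonneg (‖p.2.1‖ ^ 2), sq_nonneg ‖p.1‖,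
      mul_nonneg (sq_nonneg ‖p.2.1‖) (sq_nonneg ‖p.1‖)]
  · refine le_of_pow_le_pow_left₀ (n := 4) (by norm_num) hk ?_
    rw [h4]; nlinarith [sq_nonneg ‖p.2.1‖, sq_nonneg (‖p.1‖ ^ 2), sq_nonneg ‖p.1‖,
      mul_nonneg (sq_nonneg ‖p.2.1‖) (sq_nonneg ‖p.1‖)]
  · refine abs_le_of_sq_le_sq ?_ (by positivity)
    rw [← pow_mul, h4]
    nlinarith [sq_nonneg (‖p.1‖ ^ 2 + ‖p.2.1‖ ^ 2)]

lemma koranyiNorm_le_gauge (p : Heis n) : koranyiNorm p ≤ 3 * gauge p := by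
  have hg := gauge_nonneg p
  have hk : 0 ≤ koranyiNorm p := by unfold koranyiNorm; positivity
  have h4 : koranyiNorm p ^ 4 = (‖p.1‖ ^ 2 + ‖p.2.1‖ ^ 2) ^ 2 + 16 * p.2.2 ^ 2 := by
    unfold koranyiNorm
    rw [← Real.rpow_natCast, ← Real.rpow_mul (by positivity)]
    norm_num
  refine le_of_pow_le_pow_left₀ (n := 4) (by norm_num) (by positivity) ?_
  have h1 : ‖p.1‖ ^ 2 ≤ gauge p ^ 2 :=
    pow_le_pow_left₀ (norm_nonneg _) ((le_max_left _ _).trans (hnorm_le_gauge p)) 2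
  have h2 : ‖p.2.1‖ ^ 2 ≤ gauge p ^ 2 :=
    pow_le_pow_left₀ (norm_nonneg _) ((le_max_right _ _).trans (hnorm_le_gauge p)) 2
  have h3 : p.2.2 ^ 2 ≤ (gauge p ^ 2) ^ 2 := by
    rw [← sq_abs]
    exact pow_le_pow_left₀ (abs_nonneg _) (abs_le_gauge_sq p) 2
  have h5 : (‖p.1‖ ^ 2 + ‖p.2.1‖ ^ 2) ^ 2 ≤ (gauge p ^ 2 + gauge p ^ 2) ^ 2 :=
    pow_le_pow_left₀ (by positivity) (add_le_add h1 h2) 2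
  rw [h4]
  nlinarith [sq_nonneg (gauge p ^ 2)]

/-- `d` is comparable with the gauge distance, with constant `10`. -/
def GaugeComparable (d : Heis n → Heis n → ℝ≥0∞) : Prop :=
  ∀ p q, d p q ≤ ENNReal.ofReal (10 * gaugeDist p q) ∧
    ENNReal.ofReal (gaugeDist p q) ≤ 10 * d p q

lemma gaugeComparable_koranyiDist : GaugeComparable (koranyiDist (n := n)) := by
  intro p q
  constructor
  · refine ENNReal.ofReal_le_ofReal ((koranyiNorm_le_gauge _).trans ?_)
    have := gauge_nonneg (mul (inv p) q)
    unfold gaugeDist; linarith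
  · calc ENNReal.ofReal (gaugeDist p q) ≤ koranyiDist p q :=
          ENNReal.ofReal_le_ofReal (gauge_le_koranyiNorm _)
      _ ≤ 10 * koranyiDist p q := le_mul_of_one_le_left' (by norm_num)

end Heis

/-! ### Concatenation of horizontal paths and the triangle inequality. -/

section General

variable {E : Type*} [NormedAddCommGroup E] [NormedSpace ℝ E]
  {M : Type*} [TopologicalSpace M] [ChartedSpace E M]
  {θ : ∀ x : M, TangentSpace 𝓘(ℝ, E) x →L[ℝ] ℝ}
  {g : ∀ x : M, TangentSpace 𝓘(ℝ, E) x → TangentSpace 𝓘(ℝ, E) x → ℝ}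

lemma HorizontalPath.trans {x y z : M} {ℓ₁ ℓ₂ : ℝ≥0∞} (h₁ : HorizontalPath θ g x y ℓ₁)
    (h₂ : HorizontalPath θ g y z ℓ₂) : HorizontalPath θ g x z (ℓ₁ + ℓ₂) := by
  induction h₂ with
  | refl => simpa using h₁
  | step γ _ hγ ih =>
    rw [← add_assoc]
    exact HorizontalPath.step γ ih hγ

lemma subRiemannianDist_triangle (x y z : M) :
    subRiemannianDist θ g x z ≤ subRiemannianDist θ g x y + subRiemannianDist θ g y z := by
  unfold subRiemannianDist
  rw [ENNReal.sInf_add]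
  refine le_iInf₂ fun ℓ₁ h₁ => ?_
  rw [ENNReal.add_sInf]
  exact le_iInf₂ fun ℓ₂ h₂ => sInf_le (HorizontalPath.trans h₁ h₂)

lemma subRiemannianDist_self (x : M) : subRiemannianDist θ g x x = 0 :=
  le_antisymm (sInf_le (HorizontalPath.refl x)) bot_le

lemma subRiemannianDist_le_curveLength {γ : ℝ → M} (hγ : IsHorizontalCurve θ γ) :
    subRiemannianDist θ g (γ 0) (γ 1) ≤ curveLength g γ := by
  have := HorizontalPath.step (g := g) γ (HorizontalPath.refl _) hγ
  rw [zero_add] at this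
  exact sInf_le this

end General

lemma enorm_sub_le_lintegral_derivWithin_unitInterval {F : Type*} [NormedAddCommGroup F]
    [NormedSpace ℝ F] {f : ℝ → F} (hf : ContDiffOn ℝ 1 f (Icc 0 1)) {s : ℝ}
    (hs : s ∈ Icc (0 : ℝ) 1) :
    ‖f s - f 0‖ₑ ≤ ∫⁻ t in Icc (0 : ℝ) 1, ‖derivWithin f (Icc 0 1) t‖ₑ := by
  calc ‖f s - f 0‖ₑ ≤ ∫⁻ t in Icc (0 : ℝ) s, ‖deriv f t‖ₑ :=
        enorm_sub_le_lintegral_deriv_of_contDiffOn_Icc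
          (hf.mono (Icc_subset_Icc_right hs.2)) hs.1
    _ ≤ ∫⁻ t in Icc (0 : ℝ) 1, ‖deriv f t‖ₑ :=
        lintegral_mono_set (Icc_subset_Icc_right hs.2)
    _ = ∫⁻ t in Icc (0 : ℝ) 1, ‖derivWithin f (Icc 0 1) t‖ₑ := by
        rw [← restrict_Ioo_eq_restrict_Icc]
        refine setLIntegral_congr_fun measurableSet_Ioo fun t ht => ?_
        rw [derivWithin_of_mem_nhds (Icc_mem_nhds ht.1 ht.2)]

/-! ### Comparison of the Carnot-Carathéodory distance with the gauge. -/

namespace Heis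

variable {n : ℕ}

lemma metric_of_horizontal {p u : Heis n} (h : contactForm p u = 0) :
    metric p u u = ‖u.1‖ ^ 2 + ‖u.2.1‖ ^ 2 := by
  simp [metric, h]

lemma contactForm_horizontalField (w : EuclideanSpace ℝ (Fin n) × EuclideanSpace ℝ (Fin n))
    (p : Heis n) : contactForm p (horizontalField w p) = 0 := by
  rw [contactForm_apply, horizontalField_def]
  simp [symp]

lemma symp_horizontalField_self (w : EuclideanSpace ℝ (Fin n) × EuclideanSpace ℝ (Fin n))
    (p q : Heis n) : symp (horizontalField w p) (horizontalField w q) = 0 := by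
  simp [symp, horizontalField, real_inner_comm]

/-- A horizontal field is constant along its own integral curves, which are straight lines. -/
lemma horizontalField_add_smul (w : EuclideanSpace ℝ (Fin n) × EuclideanSpace ℝ (Fin n))
    (p : Heis n) (s : ℝ) :
    horizontalField w (p + s • horizontalField w p) = horizontalField w p := by
  have := symp_horizontalField_self w p p
  simp only [symp, horizontalField] at this
  simp only [horizontalField, Prod.fst_add, Prod.snd_add, Prod.smul_fst, Prod.smul_snd,
    inner_add_left, inner_smul_left]
  refine Prod.ext rfl (Prod.ext rfl ?_)
  simp only [conj_trivial]
  linear_combination (1 / 2) * s * this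

lemma mul_horizontal (p : Heis n) (w : EuclideanSpace ℝ (Fin n) × EuclideanSpace ℝ (Fin n)) :
    mul p (w.1, w.2, 0) = p + horizontalField w p := by
  simp [mul, horizontalField, Prod.ext_iff]

lemma curveVelocity_eq_derivWithin (γ : ℝ → Heis n) (t : ℝ) :
    curveVelocity (E := Heis n) γ t = derivWithin γ (Icc 0 1) t := by
  simp only [curveVelocity, mfderivWithin_eq_fderivWithin]
  rfl

lemma hasDerivWithinAt_line (p v : Heis n) (s : Set ℝ) (t : ℝ) :
    HasDerivWithinAt (fun t : ℝ => p + t • v) v s t := by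
  simpa using (((hasDerivAt_id t).smul_const v).const_add p).hasDerivWithinAt

/-- The straight segment from `p` in a left-invariant horizontal direction is an integral curve of
that field, hence horizontal with constant speed. -/
lemma ccDist_line_le (p : Heis n) (w : EuclideanSpace ℝ (Fin n) × EuclideanSpace ℝ (Fin n)) :
    ccDist p (mul p (w.1, w.2, 0)) ≤ ENNReal.ofReal (Real.sqrt (‖w.1‖ ^ 2 + ‖w.2‖ ^ 2)) := by
  set γ : ℝ → Heis n := fun s => p + s • horizontalField w p with hγ
  have hv : ∀ t ∈ Icc (0 : ℝ) 1,
      curveVelocity (E := Heis n) γ t = horizontalField w (γ t) := by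
    intro t ht
    rw [curveVelocity_eq_derivWithin, hγ, horizontalField_add_smul]
    exact (hasDerivWithinAt_line _ _ _ _).derivWithin (uniqueDiffOn_Icc zero_lt_one t ht)
  have hH : IsHorizontalCurve (E := Heis n) (fun p : Heis n => contactForm p) γ := by
    refine ⟨?_, fun t ht => ?_⟩
    · rw [contMDiffOn_iff_contDiffOn]
      exact (contDiff_const.add (contDiff_id.smul contDiff_const)).contDiffOn
    · rw [hv t ht]
      exact contactForm_horizontalField w _
  have h := subRiemannianDist_le_curveLength (g := fun p : Heis n => metric p) hH
  have h0 : γ 0 = p := by simp [hγ]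
  have h1 : γ 1 = mul p (w.1, w.2, 0) := by simp [hγ, mul_horizontal]
  rw [h0, h1] at h
  refine h.trans (le_of_eq ?_)
  unfold curveLength
  rw [setLIntegral_congr_fun (g := fun _ => ENNReal.ofReal (Real.sqrt (‖w.1‖ ^ 2 + ‖w.2‖ ^ 2)))
    measurableSet_Icc]
  · simp
  · intro t ht
    simp only
    rw [hv t ht, metric_of_horizontal (contactForm_horizontalField w _)]
    rfl

lemma ccDist_triangle (p q s : Heis n) : ccDist p s ≤ ccDist p q + ccDist q s :=
  subRiemannianDist_triangle p q s

/-- Commutators of horizontal translations are vertical. This is what makes the vertical direction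
reachable by horizontal curves, at the cost of a square root. -/
lemma horizontal_commutator (p u v : Heis n) (hu : u.2.2 = 0) (hv : v.2.2 = 0) :
    mul (mul (mul (mul p u) v) (-u)) (-v) = mul p (0, 0, symp u v) := by
  ext1
  · simp only [mul, Prod.fst_neg, Prod.snd_neg]; abel
  ext1
  · simp only [mul, Prod.fst_neg, Prod.snd_neg]; abel
  · simp [mul, symp, hu, hv, inner_add_left]
    rw [real_inner_comm u.1 v.2.1, real_inner_comm u.2.1 v.1, real_inner_comm u.1 u.2.1,
      real_inner_comm v.1 v.2.1]
    ring

lemma ccDist_vertical_le (hn : 1 ≤ n) (p : Heis n) (t : ℝ) :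
    ccDist p (mul p (0, 0, t)) ≤ ENNReal.ofReal (4 * Real.sqrt |t|) := by
  let i : Fin n := ⟨0, hn⟩
  set r := Real.sqrt |t| with hr
  have hr0 : 0 ≤ r := Real.sqrt_nonneg _
  have hr2 : r * r = |t| := Real.mul_self_sqrt (abs_nonneg t)
  obtain ⟨σ, hσ, hσt⟩ : ∃ σ : ℝ, |σ| = 1 ∧ σ * |t| = t := by
    rcases le_total 0 t with h | h
    · exact ⟨1, by simp, by rw [abs_of_nonneg h]; ring⟩
    · exact ⟨-1, by simp, by rw [abs_of_nonpos h]; ring⟩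
  -- Four sides of length `√|t|` along `X_i` and `Y_i` enclose symplectic area `σ r² = t`, the sign
  -- being carried by `σ`.
  set u : Heis n := (EuclideanSpace.single i r, 0, 0) with hu
  set v : Heis n := (0, EuclideanSpace.single i (σ * r), 0) with hv
  have huv : symp u v = t := by
    simp [symp, hu, hv, EuclideanSpace.inner_single_left]
    linear_combination σ * hr2 + hσt
  have key := horizontal_commutator p u v rfl rfl
  rw [huv] at key
  have e1 := ccDist_line_le p (EuclideanSpace.single i r, (0 : EuclideanSpace ℝ (Fin n)))
  have e2 := ccDist_line_le (mul p u) ((0 : EuclideanSpace ℝ (Fin n)), EuclideanSpace.single i (σ * r))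
  have e3 := ccDist_line_le (mul (mul p u) v)
    (-EuclideanSpace.single i r, -(0 : EuclideanSpace ℝ (Fin n)))
  have e4 := ccDist_line_le (mul (mul (mul p u) v) (-u))
    (-(0 : EuclideanSpace ℝ (Fin n)), -EuclideanSpace.single i (σ * r))
  have hu' : (-EuclideanSpace.single i r, -(0 : EuclideanSpace ℝ (Fin n)), (0 : ℝ)) = -u := by
    simp [hu]
  have hv' : (-(0 : EuclideanSpace ℝ (Fin n)), -EuclideanSpace.single i (σ * r), (0 : ℝ)) = -v := by
    simp [hv]
  simp only [hu', hv', ← hu, ← hv] at e1 e2 e3 e4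
  rw [key] at e4
  simp [hσ, abs_of_nonneg hr0, Real.sqrt_sq hr0] at e1 e2 e3 e4
  calc _ ≤ ccDist p (mul p u) + ccDist (mul p u) (mul (mul p u) v)
        + ccDist (mul (mul p u) v) (mul (mul (mul p u) v) (-u))
        + ccDist (mul (mul (mul p u) v) (-u)) (mul p (0, 0, t)) := by
        refine (ccDist_triangle _ (mul (mul (mul p u) v) (-u)) _).trans (add_le_add_left ?_ _)
        refine (ccDist_triangle _ (mul (mul p u) v) _).trans (add_le_add_left ?_ _)
        exact ccDist_triangle _ _ _
    _ ≤ ENNReal.ofReal r + ENNReal.ofReal r + ENNReal.ofReal r + ENNReal.ofReal r := by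
        gcongr
    _ = ENNReal.ofReal (4 * r) := by
        rw [← ENNReal.ofReal_add hr0 hr0, ← ENNReal.ofReal_add (by positivity) hr0,
          ← ENNReal.ofReal_add (by positivity) hr0]
        congr 1; ring

/-- `p⁻¹ · q` factors as a horizontal element times a vertical one. The two pieces cost at most 2
and 4 times the gauge, well below the common constant 10. -/
lemma ccDist_le_gaugeDist (hn : 1 ≤ n) (p q : Heis n) :
    ccDist p q ≤ ENNReal.ofReal (10 * gaugeDist p q) := by
  set s := mul (inv p) q with hs
  have hq : q = mul (mul p (s.1, s.2.1, 0)) (0, 0, s.2.2) := by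
    rw [mul_assoc]
    have : mul (s.1, s.2.1, 0) (0, 0, s.2.2) = s := by simp [mul]
    rw [this, hs, mul_inv_cancel_left]
  have h1 := ccDist_line_le p (s.1, s.2.1)
  have h2 := ccDist_vertical_le hn (mul p (s.1, s.2.1, 0)) s.2.2
  rw [← hq] at h2
  refine (ccDist_triangle _ _ _).trans ((add_le_add h1 h2).trans ?_)
  rw [← ENNReal.ofReal_add (Real.sqrt_nonneg _) (by positivity)]
  refine ENNReal.ofReal_le_ofReal ?_
  have hg : gaugeDist p q = gauge s := rfl
  have hg0 := gauge_nonneg s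
  have a1 : Real.sqrt |s.2.2| ≤ gauge s := le_max_right _ _
  have a2 : Real.sqrt (‖s.1‖ ^ 2 + ‖s.2.1‖ ^ 2) ≤ 2 * gauge s := by
    rw [Real.sqrt_le_left (by positivity)]
    have b1 := pow_le_pow_left₀ (norm_nonneg _) ((le_max_left _ _).trans (hnorm_le_gauge s)) 2
    have b2 := pow_le_pow_left₀ (norm_nonneg _) ((le_max_right _ _).trans (hnorm_le_gauge s)) 2
    nlinarith
  rw [hg]; simp only; linarith

lemma hnorm_le_sqrt_metric {p u : Heis n} (h : contactForm p u = 0) :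
    hnorm u ≤ Real.sqrt (metric p u u) := by
  rw [metric_of_horizontal h]
  refine max_le (Real.le_sqrt_of_sq_le ?_) (Real.le_sqrt_of_sq_le ?_)
  · nlinarith [sq_nonneg ‖u.2.1‖]
  · nlinarith [sq_nonneg ‖u.1‖]

/-- The horizontal displacement is at most the length. Horizontality expresses the growth of the
height relative to `p` as half the symplectic product of displacement and velocity, so the height is
at most the length squared. Both bounds are carried together through the concatenation, since the
second needs the first. -/
lemma horizontalPath_bounds {p q : Heis n} {ℓ : ℝ≥0∞}
    (h : HorizontalPath (E := Heis n) (M := Heis n) (fun p => contactForm p) (fun p => metric p)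
      p q ℓ) :
    ENNReal.ofReal (hnorm (q - p)) ≤ ℓ ∧ ENNReal.ofReal |(mul (inv p) q).2.2| ≤ ℓ ^ 2 := by
  induction h with
  | refl => simp [inv_mul, hnorm]
  | @step ℓ γ h hγ ih =>
    obtain ⟨ih1, ih2⟩ := ih
    set L := curveLength (E := Heis n) (M := Heis n) (fun p => metric p) γ with hL
    have hC : ContDiffOn ℝ 1 γ (Icc 0 1) := contMDiffOn_iff_contDiffOn.1 hγ.1
    have hd : ∀ t ∈ Icc (0 : ℝ) 1,
        HasDerivWithinAt γ (derivWithin γ (Icc 0 1) t) (Icc 0 1) t := fun t ht =>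
      ((hC.differentiableOn one_ne_zero) t ht).hasDerivWithinAt
    have hu : ∀ t ∈ Icc (0 : ℝ) 1, UniqueDiffWithinAt ℝ (Icc (0 : ℝ) 1) t :=
      uniqueDiffOn_Icc zero_lt_one
    have hhor : ∀ t ∈ Icc (0 : ℝ) 1, contactForm (γ t) (derivWithin γ (Icc 0 1) t) = 0 := by
      intro t ht
      rw [← curveVelocity_eq_derivWithin]
      exact hγ.2 t ht
    have hlen : ∫⁻ t in Icc (0 : ℝ) 1, ENNReal.ofReal (hnorm (derivWithin γ (Icc 0 1) t)) ≤ L := by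
      rw [hL]
      refine setLIntegral_mono' measurableSet_Icc fun t ht => ENNReal.ofReal_le_ofReal ?_
      rw [curveVelocity_eq_derivWithin]
      exact hnorm_le_sqrt_metric (hhor t ht)
    have hplane : ∀ s ∈ Icc (0 : ℝ) 1, ENNReal.ofReal (hnorm (γ s - γ 0)) ≤ L := by
      intro s hs
      let P : Heis n →L[ℝ] EuclideanSpace ℝ (Fin n) × EuclideanSpace ℝ (Fin n) :=
        (ContinuousLinearMap.fst ℝ _ _).prod
          ((ContinuousLinearMap.fst ℝ _ _).comp (ContinuousLinearMap.snd ℝ _ _))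
      have hP : ∀ v : Heis n, ‖P v‖ₑ = ENNReal.ofReal (hnorm v) := fun v => by
        rw [← ofReal_norm]; rfl
      have := enorm_sub_le_lintegral_derivWithin_unitInterval (f := fun t => P (γ t))
        (P.contDiff.comp_contDiffOn hC) hs
      rw [← map_sub, hP] at this
      have hdP : ∀ t ∈ Icc (0 : ℝ) 1, derivWithin (fun t => P (γ t)) (Icc 0 1) t
          = P (derivWithin γ (Icc 0 1) t) := fun t ht =>
        (P.hasFDerivAt.comp_hasDerivWithinAt t (hd t ht)).derivWithin (hu t ht)
      refine this.trans (le_trans (le_of_eq ?_) hlen)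
      refine setLIntegral_congr_fun measurableSet_Icc fun t ht => ?_
      rw [← hP, hdP t ht]
    have htot : ∀ s ∈ Icc (0 : ℝ) 1, ENNReal.ofReal (hnorm (γ s - p)) ≤ ℓ + L := by
      intro s hs
      have : γ s - p = (γ 0 - p) + (γ s - γ 0) := by abel
      rw [this]
      refine (ENNReal.ofReal_le_ofReal (hnorm_add_le _ _)).trans ?_
      rw [ENNReal.ofReal_add (hnorm_nonneg _) (hnorm_nonneg _)]
      exact add_le_add ih1 (hplane s hs)
    have one_mem : (1 : ℝ) ∈ Icc (0 : ℝ) 1 := ⟨zero_le_one, le_rfl⟩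
    refine ⟨htot 1 one_mem, ?_⟩
    rcases eq_or_ne (ℓ + L) ⊤ with htop | htop
    · rw [htop]; simp
    -- With the base point frozen at `p`, the form is a fixed linear functional equal, up to the
    -- constant `p.2.2`, to the height of `p⁻¹ · γ(s)`.
    let Q : Heis n →L[ℝ] ℝ := contactForm p
    have hQ : ∀ s, (mul (inv p) (γ s)).2.2 = Q (γ s) - p.2.2 := by
      intro s
      rw [contactForm_apply]
      simp [mul_def, inv, symp_neg_left]; ring
    have hvert := enorm_sub_le_lintegral_derivWithin_unitInterval
      (f := fun t => Q (γ t)) (Q.contDiff.comp_contDiffOn hC) one_mem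
    have hdQ : ∀ t ∈ Icc (0 : ℝ) 1, derivWithin (fun t => Q (γ t)) (Icc 0 1) t
        = Q (derivWithin γ (Icc 0 1) t) := fun t ht =>
      (Q.hasFDerivAt.comp_hasDerivWithinAt t (hd t ht)).derivWithin (hu t ht)
    have hb : ∫⁻ t in Icc (0 : ℝ) 1, ‖derivWithin (fun t => Q (γ t)) (Icc 0 1) t‖ₑ
        ≤ (ℓ + L) * L := by
      refine le_trans ?_ (mul_le_mul_right hlen (ℓ + L))
      rw [← lintegral_const_mul' _ _ htop]
      refine setLIntegral_mono' measurableSet_Icc fun t ht => ?_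
      rw [hdQ t ht]
      refine le_trans ?_ (mul_le_mul_left (htot t ht) _)
      rw [← ENNReal.ofReal_mul (hnorm_nonneg _), ← ofReal_norm]
      refine ENNReal.ofReal_le_ofReal ?_
      -- The velocity is horizontal at `γ t`, so evaluating the form at `p` instead leaves only the
      -- difference of the base points.
      have e : Q (derivWithin γ (Icc 0 1) t)
          = (1 / 2) * symp (γ t - p) (derivWithin γ (Icc 0 1) t) := by
        have := hhor t ht
        rw [contactForm_apply] at this ⊢
        rw [sub_eq_add_neg (γ t), symp_add_left, symp_neg_left]
        linarith
      rw [e, Real.norm_eq_abs, abs_mul]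
      have := abs_symp_le (γ t - p) (derivWithin γ (Icc 0 1) t)
      rw [abs_of_nonneg (by norm_num : (0:ℝ) ≤ 1 / 2)]
      linarith
    have e : |(mul (inv p) (γ 1)).2.2| ≤ |(mul (inv p) (γ 0)).2.2| + |Q (γ 1) - Q (γ 0)| := by
      rw [hQ, hQ]
      have := abs_add_le (Q (γ 0) - p.2.2) (Q (γ 1) - Q (γ 0))
      rwa [show Q (γ 0) - p.2.2 + (Q (γ 1) - Q (γ 0)) = Q (γ 1) - p.2.2 by ring] at this
    refine (ENNReal.ofReal_le_ofReal e).trans ?_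
    rw [ENNReal.ofReal_add (abs_nonneg _) (abs_nonneg _), ← Real.norm_eq_abs (Q _ - _),
      ofReal_norm]
    refine (add_le_add ih2 (hvert.trans hb)).trans ?_
    calc ℓ ^ 2 + (ℓ + L) * L ≤ ℓ ^ 2 + (ℓ + L) * L + ℓ * L := le_self_add
      _ = (ℓ + L) ^ 2 := by ring

lemma gaugeDist_le_ccDist (p q : Heis n) : ENNReal.ofReal (gaugeDist p q) ≤ ccDist p q := by
  refine le_sInf fun ℓ hℓ => ?_
  obtain ⟨h1, h2⟩ := horizontalPath_bounds hℓ
  rcases eq_or_ne ℓ ⊤ with rfl | htop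
  · exact le_top
  lift ℓ to NNReal using htop
  rw [← ENNReal.ofReal_coe_nnreal] at h1 h2 ⊢
  rw [ENNReal.ofReal_le_ofReal_iff ℓ.coe_nonneg] at h1
  rw [← ENNReal.ofReal_pow ℓ.coe_nonneg, ENNReal.ofReal_le_ofReal_iff (by positivity)] at h2
  refine ENNReal.ofReal_le_ofReal (gauge_le_of ℓ.coe_nonneg ?_ h2)
  convert h1 using 1
  simp [hnorm, mul, inv, neg_add_eq_sub]

lemma gaugeComparable_of_mem_standardDistances (hn : 1 ≤ n) {d : Heis n → Heis n → ℝ≥0∞}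
    (hd : d ∈ standardDistances n) : GaugeComparable d := by
  rcases hd with rfl | rfl
  · exact gaugeComparable_koranyiDist
  · exact fun p q => ⟨ccDist_le_gaugeDist hn p q,
      (gaugeDist_le_ccDist p q).trans (le_mul_of_one_le_left' (by norm_num))⟩

lemma continuous_gaugeDist_right (p : Heis n) : Continuous fun q => gaugeDist p q := by
  have h : Continuous fun q : Heis n => mul (inv p) q := by unfold mul; fun_prop
  exact continuous_gauge.comp h

/-- For the Carnot-Carathéodory distance, the triangle inequality and the upper bound by the
continuous gauge distance suffice. -/
lemma isOpen_ball (hn : 1 ≤ n) {d : Heis n → Heis n → ℝ≥0∞} (hd : d ∈ standardDistances n)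
    (s : ℝ) : IsOpen (ball d s) := by
  rcases hd with rfl | rfl
  · have : Continuous fun p : Heis n => koranyiDist 0 p := by
      unfold koranyiDist
      refine ENNReal.continuous_ofReal.comp ?_
      simp only [inv_zero, zero_mul]
      unfold koranyiNorm
      refine Continuous.rpow_const (by fun_prop) fun _ => Or.inr (by norm_num)
    exact isOpen_lt this continuous_const
  · rw [isOpen_iff_mem_nhds]
    intro p hp
    have hc : Filter.Tendsto (fun q : Heis n => ccDist 0 p + ENNReal.ofReal (10 * gaugeDist p q))
        (𝓝 p) (𝓝 (ccDist 0 p)) := by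
      have h1 : Filter.Tendsto (fun q : Heis n => ENNReal.ofReal (10 * gaugeDist p q)) (𝓝 p)
          (𝓝 0) := by
        have : Continuous fun q : Heis n => ENNReal.ofReal (10 * gaugeDist p q) :=
          ENNReal.continuous_ofReal.comp (continuous_const.mul
            (continuous_gaugeDist_right p))
        have := this.tendsto p
        simpa [gaugeDist_self] using this
      simpa using tendsto_const_nhds.add h1
    filter_upwards [hc.eventually (gt_mem_nhds hp)] with q hq
    exact ((ccDist_triangle 0 p q).trans (add_le_add_right (ccDist_le_gaugeDist hn p q) _)).trans_lt hq

end Heis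

/-! ### The exterior derivative of the contact form and of its pullbacks. -/

namespace Heis

variable {n : ℕ}

/-- The coefficients of the contact form are affine in the point, so its derivative is its linear
part. -/
lemma hasFDerivAt_contactForm (p : Heis n) :
    ∃ D : Heis n →L[ℝ] Heis n →L[ℝ] ℝ, HasFDerivAt (contactForm (n := n)) D p ∧
      ∀ u v, D u v = -(1 / 2) * symp u v := by
  let D₀ : Heis n →ₗ[ℝ] Heis n →L[ℝ] ℝ :=
    { toFun := fun u => contactForm u - contactForm 0
      map_add' := fun u v => by
        refine ContinuousLinearMap.ext fun w => ?_
        simp only [sub_apply, add_apply,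
          contactForm_apply, symp_add_left]
        have : symp (0 : Heis n) w = 0 := by simp [symp]
        rw [this]; ring
      map_smul' := fun c u => by
        refine ContinuousLinearMap.ext fun w => ?_
        simp only [sub_apply, smul_apply,
          contactForm_apply, symp_smul_left, RingHom.id_apply, smul_eq_mul]
        have : symp (0 : Heis n) w = 0 := by simp [symp]
        rw [this]; ring }
  let D : Heis n →L[ℝ] Heis n →L[ℝ] ℝ := LinearMap.toContinuousLinearMap D₀
  have hD : ∀ u, D u = contactForm u - contactForm 0 := fun u => rfl
  refine ⟨D, ?_, fun u v => ?_⟩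
  · have h := D.hasFDerivAt.add_const (contactForm 0) (x := p)
    refine h.congr_of_eventuallyEq (Filter.Eventually.of_forall fun u => ?_)
    simp [hD]
  · rw [hD, sub_apply, contactForm_apply, contactForm_apply]
    have : symp (0 : Heis n) v = 0 := by simp [symp]
    rw [this]; ring

/-- The exterior derivative of the pullback of the contact form by a `C²` map. -/
lemma extDeriv_pullback_contactForm {E : Type*} [NormedAddCommGroup E] [NormedSpace ℝ E]
    {G : E → Heis n} {z : E} (hG : ContDiffAt ℝ 2 G z) {α : E → E →L[ℝ] ℝ}
    (hα : α =ᶠ[𝓝 z] fun z => (contactForm (G z)).comp (fderiv ℝ G z)) (u v : E) :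
    fderiv ℝ α z u v - fderiv ℝ α z v u = -symp (fderiv ℝ G z u) (fderiv ℝ G z v) := by
  obtain ⟨D, hD, hDs⟩ := hasFDerivAt_contactForm (G z)
  have hG1 : HasFDerivAt G (fderiv ℝ G z) z :=
    (hG.differentiableAt two_ne_zero).hasFDerivAt
  have hG2 : HasFDerivAt (fderiv ℝ G) (fderiv ℝ (fderiv ℝ G) z) z :=
    ((hG.fderiv_right (m := 1) le_rfl).differentiableAt one_ne_zero).hasFDerivAt
  have h := (HasFDerivAt.clm_comp (hD.comp z hG1) hG2).congr_of_eventuallyEq hα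
  -- Symmetry of the second derivative cancels the second-order terms on antisymmetrizing: pullback
  -- commutes with `d`.
  have hsym : fderiv ℝ (fderiv ℝ G) z u v = fderiv ℝ (fderiv ℝ G) z v u :=
    (hG.isSymmSndFDerivAt (by simp)).eq u v
  rw [h.fderiv]
  simp only [Function.comp_apply, add_apply, ContinuousLinearMap.comp_apply,
    ContinuousLinearMap.compL_apply, ContinuousLinearMap.flip_apply, hDs, hsym]
  rw [symp_comm (fderiv ℝ G z v)]
  ring

end Heis

/-! ### Contact charts and the naturality of `dθ`. -/

section Naturality

variable {n : ℕ} {E : Type*} [NormedAddCommGroup E] [NormedSpace ℝ E]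
  {M : Type*} [TopologicalSpace M] [ChartedSpace E M]

namespace PartialDiffeomorph

variable (φ : PartialDiffeomorph 𝓘(ℝ, Heis n) 𝓘(ℝ, E) (Heis n) M ∞)

lemma symm_apply_mem {x : M} (hx : x ∈ φ.target) : φ.symm x ∈ φ.source := φ.map_target hx

lemma apply_symm_apply {x : M} (hx : x ∈ φ.target) : φ (φ.symm x) = x := φ.right_inv hx

lemma symm_apply_apply {p : Heis n} (hp : p ∈ φ.source) : φ.symm (φ p) = p := φ.left_inv hp

lemma mdifferentiableAt_symm {x : M} (hx : x ∈ φ.target) :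
    MDifferentiableAt 𝓘(ℝ, E) 𝓘(ℝ, Heis n) φ.symm x :=
  φ.symm.mdifferentiableAt (by simp) hx

lemma mfderiv_symm_mfderiv {p : Heis n} (hp : p ∈ φ.source) (v : Heis n) :
    mfderiv 𝓘(ℝ, E) 𝓘(ℝ, Heis n) φ.symm (φ p) (mfderiv 𝓘(ℝ, Heis n) 𝓘(ℝ, E) φ p v) = v := by
  have h1 := mfderiv_comp_apply p (φ.mdifferentiableAt_symm (φ.map_source hp))
    (φ.mdifferentiableAt (by simp) hp) v
  have h2 : (φ.symm ∘ φ : Heis n → Heis n) =ᶠ[𝓝 p] id := by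
    filter_upwards [φ.open_source.mem_nhds hp] with q hq using φ.left_inv hq
  rw [h2.mfderiv_eq, mfderiv_id] at h1
  exact h1.symm

lemma mfderiv_mfderiv_symm {x : M} (hx : x ∈ φ.target) (u : TangentSpace 𝓘(ℝ, E) x) :
    (mfderiv 𝓘(ℝ, Heis n) 𝓘(ℝ, E) φ (φ.symm x) (mfderiv 𝓘(ℝ, E) 𝓘(ℝ, Heis n) φ.symm x u) : E)
      = u := by
  have h1 := mfderiv_comp_apply x (φ.mdifferentiableAt (by simp) (φ.symm_apply_mem hx))
    (φ.mdifferentiableAt_symm hx) u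
  have h2 : (φ ∘ φ.symm : M → M) =ᶠ[𝓝 x] id := by
    filter_upwards [φ.open_target.mem_nhds hx] with q hq using φ.right_inv hq
  rw [h2.mfderiv_eq, mfderiv_id] at h1
  exact h1.symm

/-- `φ` pulls back the one-form `θ` to the contact form of the Heisenberg group. -/
def IsContact (θ : ∀ x : M, TangentSpace 𝓘(ℝ, E) x →L[ℝ] ℝ) : Prop :=
  ∀ p ∈ φ.source, ∀ v : Heis n,
    θ (φ p) (mfderiv 𝓘(ℝ, Heis n) 𝓘(ℝ, E) φ p v) = Heis.contactForm p v

variable {φ} {θ : ∀ x : M, TangentSpace 𝓘(ℝ, E) x →L[ℝ] ℝ}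

lemma IsContact.form_eq (hφ : φ.IsContact θ) {x : M} (hx : x ∈ φ.target)
    (u : TangentSpace 𝓘(ℝ, E) x) :
    θ x u = Heis.contactForm (φ.symm x) (mfderiv 𝓘(ℝ, E) 𝓘(ℝ, Heis n) φ.symm x u) := by
  obtain ⟨p, hp, rfl⟩ : ∃ p ∈ φ.source, φ p = x :=
    ⟨φ.symm x, φ.symm_apply_mem hx, φ.apply_symm_apply hx⟩
  have h := φ.mfderiv_mfderiv_symm hx u
  rw [φ.symm_apply_apply hp] at h ⊢
  have h' := hφ p hp (mfderiv 𝓘(ℝ, E) 𝓘(ℝ, Heis n) φ.symm (φ p) u)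
  exact (congrArg (θ (φ p)) h.symm).trans h'

variable [IsManifold 𝓘(ℝ, E) ∞ M]

/-- `formD` is computed in the preferred chart of `M`. The transition `G` from that chart to `ℍⁿ`
pulls the contact form back to `θ` read in the chart, so the formula for pullbacks applies to `G`.
-/
lemma IsContact.formD_eq (hφ : φ.IsContact θ) {x : M} (hx : x ∈ φ.target)
    (u v : TangentSpace 𝓘(ℝ, E) x) :
    formD θ x u v = -Heis.symp (mfderiv 𝓘(ℝ, E) 𝓘(ℝ, Heis n) φ.symm x u)
      (mfderiv 𝓘(ℝ, E) 𝓘(ℝ, Heis n) φ.symm x v) := by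
  set e := extChartAt 𝓘(ℝ, E) x with he
  set G : E → Heis n := fun z => φ.symm (e.symm z) with hG
  set U : Set E := e.target ∩ e.symm ⁻¹' φ.target with hU
  have hxs : x ∈ e.source := mem_extChartAt_source x
  have hUo : IsOpen U :=
    (continuousOn_extChartAt_symm x).isOpen_inter_preimage (isOpen_extChartAt_target x)
      φ.open_target
  have hz : e x ∈ U := ⟨e.map_source hxs, by
    rw [mem_preimage, e.left_inv hxs]; exact hx⟩
  have hes : ∀ z ∈ U, MDifferentiableAt 𝓘(ℝ, E) 𝓘(ℝ, E) e.symm z := fun z hz =>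
    ((contMDiffOn_extChartAt_symm (n := ∞) x).mdifferentiableOn (by simp) z
      hz.1).mdifferentiableAt ((isOpen_extChartAt_target x).mem_nhds hz.1)
  have hGs : ContMDiffOn 𝓘(ℝ, E) 𝓘(ℝ, Heis n) ∞ G U :=
    φ.contMDiffOn_invFun.comp ((contMDiffOn_extChartAt_symm x).mono inter_subset_left)
      inter_subset_right
  have hGd : ∀ z ∈ U, ∀ w : E, (fderiv ℝ G z w : Heis n) =
      mfderiv 𝓘(ℝ, E) 𝓘(ℝ, Heis n) φ.symm (e.symm z)
        (mfderiv 𝓘(ℝ, E) 𝓘(ℝ, E) e.symm z w) := by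
    intro z hz w
    have := mfderiv_comp_apply z (φ.mdifferentiableAt_symm hz.2) (hes z hz) w
    rw [← this, ← mfderiv_eq_fderiv]
    rfl
  have hGc : ContDiffAt ℝ 2 G (e x) :=
    ((contMDiffOn_iff_contDiffOn.1 hGs).contDiffAt (hUo.mem_nhds hz)).of_le (by
      norm_cast)
  have hα : formInChart θ x =ᶠ[𝓝 (e x)] fun z => (Heis.contactForm (G z)).comp (fderiv ℝ G z) := by
    filter_upwards [hUo.mem_nhds hz] with z hz
    refine ContinuousLinearMap.ext fun w => ?_
    rw [ContinuousLinearMap.comp_apply, hGd z hz w]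
    exact hφ.form_eq hz.2 _
  have hc : ∀ w : TangentSpace 𝓘(ℝ, E) x,
      (fderiv ℝ G (e x) (mfderiv 𝓘(ℝ, E) 𝓘(ℝ, E) e x w : E) : Heis n) =
        mfderiv 𝓘(ℝ, E) 𝓘(ℝ, Heis n) φ.symm x w := by
    intro w
    have hGm : MDifferentiableAt 𝓘(ℝ, E) 𝓘(ℝ, Heis n) G (e x) :=
      (hGc.differentiableAt two_ne_zero).mdifferentiableAt
    have h1 := mfderiv_comp_apply x hGm
      (mdifferentiableAt_extChartAt (I := 𝓘(ℝ, E)) (mem_chart_source E x)) w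
    have h2 : (G ∘ e : M → Heis n) =ᶠ[𝓝 x] φ.symm := by
      filter_upwards [extChartAt_source_mem_nhds (I := 𝓘(ℝ, E)) x] with y hy
      simp only [hG, Function.comp_apply, he]
      rw [(extChartAt 𝓘(ℝ, E) x).left_inv hy]
    rw [h2.mfderiv_eq, mfderiv_eq_fderiv] at h1
    exact h1.symm
  have key := Heis.extDeriv_pullback_contactForm hGc hα
    (mfderiv 𝓘(ℝ, E) 𝓘(ℝ, E) e x u : E) (mfderiv 𝓘(ℝ, E) 𝓘(ℝ, E) e x v : E)
  rw [hc, hc] at key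
  exact key

end PartialDiffeomorph

end Naturality

/-! ### The endomorphism `J` in a contact chart, and the length of horizontal vectors. -/

lemma continuousOn_totalSpace_const {F : Type*} [NormedAddCommGroup F] [NormedSpace ℝ F] (v : F)
    (s : Set F) :
    ContinuousOn (fun q : F => (⟨q, v⟩ : TangentBundle 𝓘(ℝ, F) F)) s := by
  have : Continuous fun q : F => (⟨q, v⟩ : TangentBundle 𝓘(ℝ, F) F) :=
    (contMDiff_vectorSpace_iff_contDiff (n := 0) (V := fun _ => v)).2 contDiff_const |>.continuous
  exact this.continuousOn

lemma ContinuousOn.totalSpace_snd_of_vectorSpace {X F : Type*} [TopologicalSpace X]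
    [NormedAddCommGroup F] [NormedSpace ℝ F] {f : X → TangentBundle 𝓘(ℝ, F) F} {s : Set X}
    (hf : ContinuousOn f s) : ContinuousOn (fun x => ((f x).2 : F)) s := by
  have h := (tangentBundleModelSpaceHomeomorph 𝓘(ℝ, F)).continuous.comp_continuousOn hf
  have h2 : Continuous (fun z : ModelProd F F => (z.2 : F)) := continuous_snd (X := F) (Y := F)
  exact h2.comp_continuousOn h

namespace ContactSubRiemannian

variable {n : ℕ} {E : Type*} [NormedAddCommGroup E] [NormedSpace ℝ E]
  {M : Type*} [TopologicalSpace M] [ChartedSpace E M] [IsManifold 𝓘(ℝ, E) ∞ M]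
  (S : ContactSubRiemannian (E := E) M)
  {φ : PartialDiffeomorph 𝓘(ℝ, Heis n) 𝓘(ℝ, E) (Heis n) M ∞}

/-- The field of endomorphisms `J` read in the chart `φ`. -/
def pullbackJ (φ : PartialDiffeomorph 𝓘(ℝ, Heis n) 𝓘(ℝ, E) (Heis n) M ∞) (q v : Heis n) : Heis n :=
  mfderiv 𝓘(ℝ, E) 𝓘(ℝ, Heis n) φ.symm (φ q)
    (S.J (φ q) (mfderiv 𝓘(ℝ, Heis n) 𝓘(ℝ, E) φ q v))

lemma pullbackJ_smul (q v : Heis n) (c : ℝ) :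
    S.pullbackJ φ q (c • v) = c • S.pullbackJ φ q v := by
  unfold pullbackJ
  have h1 := (mfderiv 𝓘(ℝ, Heis n) 𝓘(ℝ, E) φ q).map_smul c v
  have h2 := (S.J (φ q)).map_smul c (mfderiv 𝓘(ℝ, Heis n) 𝓘(ℝ, E) φ q v)
  have h3 := (mfderiv 𝓘(ℝ, E) 𝓘(ℝ, Heis n) φ.symm (φ q)).map_smul c
    (S.J (φ q) (mfderiv 𝓘(ℝ, Heis n) 𝓘(ℝ, E) φ q v))
  exact (congrArg _ ((congrArg _ h1).trans h2)).trans h3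

/-- The pulled-back `J` is the composite of the tangent map of `φ`, the bundle map `J` and the
tangent map of `φ.symm`, each continuous on the tangent bundle. -/
lemma continuousOn_pullbackJ (v : Heis n) :
    ContinuousOn (fun q => S.pullbackJ φ q v) φ.source := by
  have h1 : ContinuousOn (fun q : Heis n => (⟨φ q, mfderiv 𝓘(ℝ, Heis n) 𝓘(ℝ, E) φ q v⟩ :
      TangentBundle 𝓘(ℝ, E) M)) φ.source := by
    have h := (φ.contMDiffOn_toFun.continuousOn_tangentMapWithin (by simp)
      φ.open_source.uniqueMDiffOn).comp (continuousOn_totalSpace_const v φ.source)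
      (fun q hq => hq)
    refine h.congr fun q hq => ?_
    simp only [Function.comp_apply, tangentMapWithin]
    rw [mfderivWithin_of_mem_nhds (φ.open_source.mem_nhds hq)]
  have hJ : ContinuousOn (fun q : Heis n => Bundle.TotalSpace.mk' (E →L[ℝ] E)
      (E := fun x : M => TangentSpace 𝓘(ℝ, E) x →L[ℝ] TangentSpace 𝓘(ℝ, E) x) (φ q)
      (S.J (φ q))) φ.source :=
    S.J_smooth.continuous.comp_continuousOn φ.contMDiffOn_toFun.continuousOn
  have h2 := hJ.clm_bundle_apply h1
  have h3 := (φ.symm.contMDiffOn_toFun.continuousOn_tangentMapWithin (by simp)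
      φ.open_target.uniqueMDiffOn).comp h2 (fun q hq => φ.map_source hq)
  have h4 := ContinuousOn.totalSpace_snd_of_vectorSpace h3
  refine h4.congr fun q hq => ?_
  have := mfderivWithin_of_mem_nhds (I := 𝓘(ℝ, E)) (I' := 𝓘(ℝ, Heis n)) (f := φ.symm)
    (φ.open_target.mem_nhds (φ.map_source hq))
  simp only [Function.comp_apply, tangentMapWithin, pullbackJ]
  exact (congrArg (fun T => T (S.J (φ q) (mfderiv 𝓘(ℝ, Heis n) 𝓘(ℝ, E) φ q v))) this).symm

variable {S}

/-- Since the symplectic form on the right does not depend on the point, the length of a fixed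
vector varies continuously as soon as the pulled-back `J` does. -/
lemma metric_mfderiv (hφ : φ.IsContact S.θ) {p : Heis n} (hp : p ∈ φ.source) {v : Heis n}
    (hv : Heis.contactForm p v = 0) :
    S.metric (φ p) (mfderiv 𝓘(ℝ, Heis n) 𝓘(ℝ, E) φ p v) (mfderiv 𝓘(ℝ, Heis n) 𝓘(ℝ, E) φ p v)
      = -Heis.symp v (S.pullbackJ φ p v) := by
  unfold metric
  rw [hφ p hp, hv, hφ.formD_eq (φ.map_source hp)]
  have := φ.mfderiv_symm_mfderiv hp v
  rw [MulZeroClass.zero_mul, zero_add, pullbackJ]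
  exact congrArg (fun x => -Heis.symp x _) this

/-- A chart that does not decrease the distance too much does not decrease the length of
horizontal vectors too much. -/
lemma hnorm_le_of_gaugeDist_le (hφ : φ.IsContact S.θ) {p : Heis n} (hp : p ∈ φ.source) {K : ℝ}
    (hK : 0 ≤ K) (hlow : ∀ q ∈ φ.source, ENNReal.ofReal (Heis.gaugeDist p q) ≤
      ENNReal.ofReal K * S.subDist (φ p) (φ q))
    (w : EuclideanSpace ℝ (Fin n) × EuclideanSpace ℝ (Fin n)) :
    Heis.hnorm (Heis.horizontalField w p) ≤ K * Real.sqrt (S.metric (φ p)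
      (mfderiv 𝓘(ℝ, Heis n) 𝓘(ℝ, E) φ p (Heis.horizontalField w p))
      (mfderiv 𝓘(ℝ, Heis n) 𝓘(ℝ, E) φ p (Heis.horizontalField w p))) := by
  set X := Heis.horizontalField w p with hX
  have hXq : ∀ σ : ℝ, Heis.contactForm (p + σ • X) X = 0 := by
    intro σ
    have := Heis.contactForm_horizontalField w (p + σ • X)
    rwa [hX, Heis.horizontalField_add_smul, ← hX] at this
  set h : ℝ → ℝ := fun σ => Real.sqrt (-Heis.symp X (S.pullbackJ φ (p + σ • X) X)) with hh
  have hX0 : Heis.contactForm p X = 0 := Heis.contactForm_horizontalField w p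
  rw [metric_mfderiv hφ hp hX0]
  have hline : Continuous fun σ : ℝ => p + σ • X := by fun_prop
  have h0 : p + (0 : ℝ) • X = p := by simp
  have hopen : IsOpen ((fun σ : ℝ => p + σ • X) ⁻¹' φ.source) := φ.open_source.preimage hline
  have hmem0 : (0 : ℝ) ∈ (fun σ : ℝ => p + σ • X) ⁻¹' φ.source := by
    rw [mem_preimage, h0]; exact hp
  have hcont : ContinuousAt h 0 := by
    have c1 : ContinuousOn (fun σ : ℝ => S.pullbackJ φ (p + σ • X) X)
        ((fun σ : ℝ => p + σ • X) ⁻¹' φ.source) :=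
      (S.continuousOn_pullbackJ X).comp hline.continuousOn fun _ h => h
    have c2 : Continuous fun u : Heis n => Real.sqrt (-Heis.symp X u) := by
      unfold Heis.symp; fun_prop
    exact (c2.comp_continuousOn c1).continuousAt (hopen.mem_nhds hmem0)
  have hval : h 0 = Real.sqrt (-Heis.symp X (S.pullbackJ φ p X)) := by simp only [hh, h0]
  rw [← hval]
  have hh0 : 0 ≤ h 0 := Real.sqrt_nonneg _
  -- By continuity the speed along a short segment is at most `h 0 + ε`; letting `ε → 0` recovers
  -- the speed at `p` itself.
  suffices hε : ∀ ε > 0, Heis.hnorm X ≤ K * (h 0 + ε) by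
    have ht : Filter.Tendsto (fun ε : ℝ => K * (h 0 + ε)) (𝓝[>] 0) (𝓝 (K * (h 0 + 0))) :=
      Filter.Tendsto.mono_left (Continuous.tendsto (by fun_prop) 0) nhdsWithin_le_nhds
    rw [add_zero] at ht
    exact ge_of_tendsto ht (Filter.eventually_of_mem self_mem_nhdsWithin fun ε hε' => hε ε hε')
  intro ε hε
  have hev : ∀ᶠ σ in 𝓝 (0 : ℝ), p + σ • X ∈ φ.source ∧ h σ < h 0 + ε :=
    (hopen.eventually_mem hmem0).and (hcont.eventually (gt_mem_nhds (by linarith)))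
  obtain ⟨δ, hδ, hball⟩ := Metric.eventually_nhds_iff.1 hev
  set t := δ / 2 with ht
  have ht0 : 0 < t := by positivity
  have hIcc : ∀ s ∈ Icc (0 : ℝ) 1, p + (s * t) • X ∈ φ.source ∧ h (s * t) < h 0 + ε := by
    intro s hs
    apply hball
    rw [Real.dist_eq, sub_zero, abs_of_nonneg (mul_nonneg hs.1 ht0.le)]
    have : s * t ≤ 1 * t := mul_le_mul_of_nonneg_right hs.2 ht0.le
    linarith
  set c : ℝ → Heis n := fun s => p + s • (t • X) with hc
  have hcs : ∀ s, c s = p + (s * t) • X := fun s => by rw [hc, mul_smul]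
  set γ : ℝ → M := fun s => φ (c s) with hγ
  have hcsrc : ∀ s ∈ Icc (0 : ℝ) 1, c s ∈ φ.source := fun s hs => by
    rw [hcs]; exact (hIcc s hs).1
  have hv : ∀ s ∈ Icc (0 : ℝ) 1, (curveVelocity (E := E) γ s : E) =
      mfderiv 𝓘(ℝ, Heis n) 𝓘(ℝ, E) φ (c s) (t • X) := by
    intro s hs
    have hd : HasMFDerivWithinAt 𝓘(ℝ, ℝ) 𝓘(ℝ, Heis n) c (Icc 0 1) s
        (ContinuousLinearMap.toSpanSingleton ℝ (t • X)) :=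
      (Heis.hasDerivWithinAt_line p (t • X) (Icc 0 1) s).hasFDerivWithinAt.hasMFDerivWithinAt
    have hφd := (φ.mdifferentiableAt (by simp) (hcsrc s hs)).hasMFDerivAt
    have := (hφd.comp_hasMFDerivWithinAt s hd).mfderivWithin
      ((uniqueDiffOn_Icc zero_lt_one s hs).uniqueMDiffWithinAt)
    unfold curveVelocity
    rw [show γ = φ ∘ c from rfl, this]
    have e : (ContinuousLinearMap.toSpanSingleton ℝ (t • X)) (1 : ℝ) = t • X := by simp
    exact congrArg (mfderiv 𝓘(ℝ, Heis n) 𝓘(ℝ, E) φ (c s)) e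
  have hcf : ∀ s, Heis.contactForm (c s) (t • X) = 0 := fun s => by
    rw [map_smul, hcs, hXq, smul_zero]
  have hH : IsHorizontalCurve (E := E) S.θ γ := by
    refine ⟨?_, fun s hs => ?_⟩
    · have hc1 : ContMDiffOn 𝓘(ℝ, ℝ) 𝓘(ℝ, Heis n) 1 c (Icc 0 1) := by
        rw [contMDiffOn_iff_contDiffOn]
        exact (contDiff_const.add (contDiff_id.smul contDiff_const)).contDiffOn
      exact (φ.contMDiffOn_toFun.of_le (by norm_cast)).comp hc1 hcsrc
    · refine (congrArg (S.θ (γ s)) (hv s hs)).trans ?_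
      rw [hφ _ (hcsrc s hs), hcf]
  have hlen : curveLength S.metric γ ≤ ENNReal.ofReal (t * (h 0 + ε)) := by
    have : ∀ s ∈ Icc (0 : ℝ) 1, ENNReal.ofReal (Real.sqrt (S.metric (γ s)
        (curveVelocity γ s) (curveVelocity γ s))) ≤ ENNReal.ofReal (t * (h 0 + ε)) := by
      intro s hs
      refine ENNReal.ofReal_le_ofReal ?_
      have e : S.metric (γ s) (curveVelocity γ s) (curveVelocity γ s) =
          t ^ 2 * (-Heis.symp X (S.pullbackJ φ (p + (s * t) • X) X)) := by
        have e1 := metric_mfderiv hφ (hcsrc s hs) (hcf s)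
        rw [pullbackJ_smul, Heis.symp_smul_left, Heis.symp_smul_right, hcs] at e1
        refine (congrArg (fun u => S.metric (γ s) u u) (hv s hs)).trans ?_
        rw [← hcs] at e1 ⊢
        refine e1.trans ?_
        ring
      rw [e, Real.sqrt_mul (sq_nonneg t), Real.sqrt_sq ht0.le]
      exact mul_le_mul_of_nonneg_left (hIcc s hs).2.le ht0.le
    calc curveLength S.metric γ ≤ ∫⁻ _ in Icc (0 : ℝ) 1, ENNReal.ofReal (t * (h 0 + ε)) :=
          setLIntegral_mono' measurableSet_Icc this
      _ = _ := by simp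
  have hdist := (subRiemannianDist_le_curveLength (g := S.metric) hH).trans hlen
  have g0 : γ 0 = φ p := by simp [hγ, hc]
  have g1 : γ 1 = φ (c 1) := rfl
  rw [g0, g1] at hdist
  have hfin := (hlow (c 1) (hcsrc 1 ⟨zero_le_one, le_rfl⟩)).trans
    (mul_le_mul_right hdist (ENNReal.ofReal K))
  rw [← ENNReal.ofReal_mul hK, ENNReal.ofReal_le_ofReal_iff (by positivity)] at hfin
  -- The segment has gauge length at least `t · hnorm X`, while its image has length at most `t (h 0
  -- + ε)`. The lower Lipschitz bound compares them and `t` cancels.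
  have hg : t * Heis.hnorm X ≤ Heis.gaugeDist p (c 1) := by
    refine le_trans (le_of_eq ?_) (Heis.hnorm_le_gauge _)
    have : t * Heis.hnorm X = Heis.hnorm (t • X) := by
      rw [Heis.hnorm_smul, abs_of_pos ht0]
    rw [this]
    simp [Heis.hnorm, Heis.mul, Heis.inv, hc]
  have : t * Heis.hnorm X ≤ t * (K * (h 0 + ε)) := by linarith
  exact le_of_mul_le_mul_left this ht0

end ContactSubRiemannian

/-! ### Completeness forces chart domains to be uniformly large. -/

namespace Heis

variable {n : ℕ}

lemma gauge_smul_le (p : Heis n) {s : ℝ} (hs : s ∈ Icc (0 : ℝ) 1) : gauge (s • p) ≤ gauge p := by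
  refine gauge_le_of (gauge_nonneg p) ?_ ?_
  · rw [hnorm_smul, abs_of_nonneg hs.1]
    exact (mul_le_of_le_one_left (hnorm_nonneg p) hs.2).trans (hnorm_le_gauge p)
  · simp only [Prod.smul_snd, smul_eq_mul, abs_mul, abs_of_nonneg hs.1]
    exact (mul_le_of_le_one_left (abs_nonneg _) hs.2).trans (abs_le_gauge_sq p)

end Heis

namespace ContactSubRiemannian

variable {n : ℕ} {E : Type*} [NormedAddCommGroup E] [NormedSpace ℝ E]
  {M : Type*} [TopologicalSpace M] [ChartedSpace E M] [IsManifold 𝓘(ℝ, E) ∞ M]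
  {S : ContactSubRiemannian (E := E) M}

lemma subDist_triangle (x y z : M) : S.subDist x z ≤ S.subDist x y + S.subDist y z :=
  subRiemannianDist_triangle x y z

lemma subDist_self (x : M) : S.subDist x x = 0 := subRiemannianDist_self x

/-- By completeness, the domain of a bi-Lipschitz chart whose image contains the ball of radius `r`
around `φ p` contains a ball around `p` of comparable radius. -/
lemma mem_of_gaugeDist_lt (hS : S.IsMetricComplete) {φ : Heis n → M} {U : Set (Heis n)}
    (hU : IsOpen U) {K r : ℝ} (hK : 0 ≤ K)
    (hup : ∀ p ∈ U, ∀ q ∈ U, S.subDist (φ p) (φ q) ≤ ENNReal.ofReal (K * Heis.gaugeDist p q))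
    (hlow : ∀ p ∈ U, ∀ q ∈ U, ENNReal.ofReal (Heis.gaugeDist p q) ≤
      ENNReal.ofReal K * S.subDist (φ p) (φ q))
    {p q : Heis n} (hp : p ∈ U) (hball : {b | S.subDist (φ p) b < ENNReal.ofReal r} ⊆ φ '' U)
    (hpq : K * Heis.gaugeDist p q < r) : q ∈ U := by
  by_contra hq
  -- This path joins `p` to `q` without exceeding the gauge distance `gaugeDist p q` from `p`.
  set γ : ℝ → Heis n := fun s => Heis.mul p (s • Heis.mul (Heis.inv p) q) with hγ
  have hγc : Continuous γ := by
    have h : Continuous fun x : Heis n => Heis.mul p x := by unfold Heis.mul; fun_prop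
    exact h.comp (continuous_id.smul continuous_const)
  have hγ0 : γ 0 = p := by simp [hγ, Heis.mul_zero]
  have hγ1 : γ 1 = q := by simp [hγ, Heis.mul_inv_cancel_left]
  have hγd : ∀ s ∈ Icc (0 : ℝ) 1, Heis.gaugeDist p (γ s) ≤ Heis.gaugeDist p q := by
    intro s hs
    have e : Heis.gaugeDist p (γ s) = Heis.gauge (s • Heis.mul (Heis.inv p) q) := by
      rw [Heis.gaugeDist, hγ, Heis.inv_mul_cancel_left]
    rw [e]
    exact Heis.gauge_smul_le _ hs
  -- The infimum `τ` of `A` is the first exit time from `U`, and it is attained because `U` is open.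
  set A : Set ℝ := Icc 0 1 ∩ γ ⁻¹' Uᶜ with hA
  have hAc : IsCompact A := isCompact_Icc.inter_right (hU.isClosed_compl.preimage hγc)
  have hAne : A.Nonempty := ⟨1, ⟨zero_le_one, le_rfl⟩, by rw [mem_preimage, hγ1]; exact hq⟩
  have hmem : sInf A ∈ A := hAc.sInf_mem hAne
  set τ := sInf A with hτ
  have hτ0 : 0 < τ := by
    rcases hmem.1.1.eq_or_lt with h | h
    · exact absurd hp (by have := hmem.2; rwa [← h, mem_preimage, hγ0] at this)
    · exact h
  have hlt : ∀ s, 0 ≤ s → s < τ → γ s ∈ U := by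
    intro s h0 h1
    by_contra hs
    exact absurd (csInf_le hAc.bddBelow ⟨⟨h0, h1.le.trans hmem.1.2⟩, hs⟩) (not_le.2 h1)
  set σ : ℕ → ℝ := fun i => τ * (1 - 1 / ((i : ℝ) + 1)) with hσ
  have hσt : Filter.Tendsto σ Filter.atTop (𝓝 τ) := by
    have := (tendsto_one_div_add_atTop_nhds_zero_nat (𝕜 := ℝ)).const_sub 1 |>.const_mul τ
    simpa [hσ] using this
  have hσ0 : ∀ i, 0 ≤ σ i := fun i => by
    have : 1 / ((i : ℝ) + 1) ≤ 1 := by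
      rw [div_le_one (by positivity)]; linarith [(Nat.cast_nonneg i : (0 : ℝ) ≤ i)]
    exact mul_nonneg hτ0.le (by linarith)
  have hσ1 : ∀ i, σ i < τ := fun i => by
    have : 0 < 1 / ((i : ℝ) + 1) := by positivity
    have := mul_pos hτ0 this
    simp only [hσ]; linarith
  have hσU : ∀ i, γ (σ i) ∈ U := fun i => hlt _ (hσ0 i) (hσ1 i)
  have hγσ : Filter.Tendsto (fun i => γ (σ i)) Filter.atTop (𝓝 (γ τ)) :=
    (hγc.tendsto τ).comp hσt
  -- Parameters increasing to `τ` give a convergent sequence in `ℍⁿ`; the upper Lipschitz bound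
  -- makes its image Cauchy, so completeness supplies a limit `b`.
  obtain ⟨b, hb⟩ := hS (fun i => φ (γ (σ i))) (by
    intro ε hε
    have h1 : Filter.Tendsto (fun ij : ℕ × ℕ => ENNReal.ofReal
        (K * Heis.gaugeDist (γ (σ ij.1)) (γ (σ ij.2)))) (Filter.atTop ×ˢ Filter.atTop) (𝓝 0) := by
      have h2 : Continuous fun pq : Heis n × Heis n => ENNReal.ofReal
          (K * Heis.gaugeDist pq.1 pq.2) :=
        ENNReal.continuous_ofReal.comp (continuous_const.mul Heis.continuous_gaugeDist)
      have h3 := (h2.tendsto (γ τ, γ τ))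
      rw [nhds_prod_eq] at h3
      have h4 := h3.comp (hγσ.prodMap hγσ)
      simpa [Heis.gaugeDist_self, Function.comp_def] using h4
    have h5 := h1.eventually (gt_mem_nhds hε)
    rw [Filter.prod_atTop_atTop_eq, Filter.eventually_atTop] at h5
    obtain ⟨⟨N₁, N₂⟩, hN⟩ := h5
    refine ⟨max N₁ N₂, fun i hi j hj => ?_⟩
    exact (hup _ (hσU i) _ (hσU j)).trans_lt
      (hN (i, j) ⟨(le_max_left _ _).trans hi, (le_max_right _ _).trans hj⟩))
  have hbr : S.subDist (φ p) b < ENNReal.ofReal r := by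
    have hr : 0 < r := (mul_nonneg hK (Heis.gauge_nonneg _)).trans_lt hpq
    have h1 : Filter.Tendsto (fun i => ENNReal.ofReal (K * Heis.gaugeDist p q) +
        S.subDist (φ (γ (σ i))) b) Filter.atTop (𝓝 (ENNReal.ofReal (K * Heis.gaugeDist p q))) := by
      simpa using tendsto_const_nhds.add hb
    obtain ⟨i, hi⟩ := (h1.eventually (gt_mem_nhds
      ((ENNReal.ofReal_lt_ofReal_iff hr).2 hpq))).exists
    refine lt_of_le_of_lt ((subDist_triangle _ (φ (γ (σ i))) _).trans (add_le_add_left ?_ _)) hi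
    refine (hup _ hp _ (hσU i)).trans (ENNReal.ofReal_le_ofReal ?_)
    exact mul_le_mul_of_nonneg_left
      (hγd _ ⟨hσ0 i, (hσ1 i).le.trans hmem.1.2⟩) hK
  -- The limit lies in the ball covered by the chart. The lower Lipschitz bound then identifies `q'`
  -- with `γ τ`, contradicting the exit from `U`.
  obtain ⟨q', hq', rfl⟩ := hball hbr
  have h1 : Filter.Tendsto (fun i => ENNReal.ofReal (Heis.gaugeDist (γ (σ i)) q'))
      Filter.atTop (𝓝 0) := by
    have h2 := ENNReal.Tendsto.const_mul (a := ENNReal.ofReal K) hb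
      (Or.inr ENNReal.ofReal_ne_top)
    rw [MulZeroClass.mul_zero] at h2
    exact tendsto_of_tendsto_of_tendsto_of_le_of_le tendsto_const_nhds h2 (fun _ => bot_le)
      fun i => hlow _ (hσU i) _ hq'
  have h2 : Filter.Tendsto (fun i => ENNReal.ofReal (Heis.gaugeDist (γ (σ i)) q'))
      Filter.atTop (𝓝 (ENNReal.ofReal (Heis.gaugeDist (γ τ) q'))) := by
    have h3 := (Heis.continuous_gaugeDist.tendsto (γ τ, q')).comp
      (hγσ.prodMk_nhds tendsto_const_nhds)
    exact (ENNReal.continuous_ofReal.tendsto _).comp h3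
  have h3 := ENNReal.ofReal_eq_zero.1 (tendsto_nhds_unique h2 h1)
  have h4 := Heis.eq_of_gaugeDist_eq_zero (le_antisymm h3 (Heis.gauge_nonneg _))
  exact hmem.2 (h4 ▸ hq')

end ContactSubRiemannian

namespace Heis

variable {n : ℕ}

/-! ### Symplectic automorphisms -/

/-- `symp` as a bilinear form. -/
def sympForm : Heis n →ₗ[ℝ] Heis n →ₗ[ℝ] ℝ :=
  LinearMap.mk₂ ℝ symp symp_add_left symp_smul_left symp_add_right symp_smul_right

lemma sympForm_apply (u v : Heis n) : sympForm u v = symp u v := rfl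

/-- The horizontal coordinates of a point. -/
def coord (p : Heis n) : Fin n ⊕ Fin n → ℝ := Sum.elim (fun i => p.1 i) fun i => p.2.1 i

/-- The values of the symplectic form on the standard frame. -/
def sympMatrix : Fin n ⊕ Fin n → Fin n ⊕ Fin n → ℝ
  | Sum.inl i, Sum.inr j => if i = j then 1 else 0
  | Sum.inr i, Sum.inl j => if i = j then -1 else 0
  | _, _ => 0

lemma symp_eq_sum (p q : Heis n) :
    symp p q = ∑ k, ∑ l, coord p k * coord q l * sympMatrix k l := by
  simp [Fintype.sum_sum_type, coord, sympMatrix, symp, PiLp.inner_apply, mul_comm,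
    sub_eq_add_neg]

lemma abs_coord_le (p : Heis n) (k : Fin n ⊕ Fin n) : |coord p k| ≤ hnorm p := by
  rcases k with i | i
  · exact (PiLp.norm_apply_le p.1 i).trans (le_max_left _ _)
  · exact (PiLp.norm_apply_le p.2.1 i).trans (le_max_right _ _)

/-- The linear map which sends the standard basis to `w` and `T` to `T`. -/
def frameMap (w : Fin n ⊕ Fin n → Heis n) : Heis n →ₗ[ℝ] Heis n where
  toFun p := ∑ k, coord p k • w k + p.2.2 • ((0, 0, 1) : Heis n)
  map_add' p q := by
    have : ∀ k, coord (p + q) k = coord p k + coord q k := by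
      rintro (i | i) <;> simp [coord]
    simp only [this, add_smul, Finset.sum_add_distrib, Prod.snd_add]
    abel
  map_smul' c p := by
    have : ∀ k, coord (c • p) k = c * coord p k := by
      rintro (i | i) <;> simp [coord]
    simp only [this, mul_smul, ← Finset.smul_sum, Prod.smul_snd, smul_add, RingHom.id_apply,
      smul_eq_mul]

section frameMap

variable {w : Fin n ⊕ Fin n → Heis n}

lemma frameMap_apply (p : Heis n) :
    frameMap w p = ∑ k, coord p k • w k + p.2.2 • ((0, 0, 1) : Heis n) := rfl

lemma symp_frameMap (hw : ∀ k l, symp (w k) (w l) = sympMatrix k l) (p q : Heis n) :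
    symp (frameMap w p) (frameMap w q) = symp p q := by
  have e : ∀ p q : Heis n, symp (frameMap w p) (frameMap w q) =
      sympForm (∑ k, coord p k • w k) (∑ k, coord q k • w k) := by
    intro p q
    refine symp_congr ?_ ?_ ?_ ?_ <;> simp [frameMap_apply]
  rw [e, symp_eq_sum]
  simp only [map_sum, LinearMap.sum_apply, map_smul, LinearMap.smul_apply, sympForm_apply, hw,
    smul_eq_mul]
  rw [Finset.sum_comm]
  refine Finset.sum_congr rfl fun k _ => ?_
  rw [Finset.mul_sum]
  exact Finset.sum_congr rfl fun l _ => by ring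

lemma frameMap_vertical (hv : ∀ k, (w k).2.2 = 0) (p : Heis n) : (frameMap w p).2.2 = p.2.2 := by
  simp [frameMap_apply, Prod.snd_sum, hv]

lemma hnorm_sum_le {ι : Type*} (s : Finset ι) (f : ι → Heis n) :
    hnorm (∑ i ∈ s, f i) ≤ ∑ i ∈ s, hnorm (f i) := by
  classical
  induction s using Finset.induction_on with
  | empty => simp [hnorm]
  | insert a s ha ih =>
    rw [Finset.sum_insert ha, Finset.sum_insert ha]
    exact (hnorm_add_le _ _).trans (add_le_add_right ih _)

lemma hnorm_frameMap_le {B : ℝ} (hB : ∀ k, hnorm (w k) ≤ B) (p : Heis n) :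
    hnorm (frameMap w p) ≤ 2 * n * B * hnorm p := by
  have h0 : hnorm (frameMap w p) = hnorm (∑ k, coord p k • w k) := by
    simp [hnorm, frameMap_apply]
  rw [h0]
  refine (hnorm_sum_le _ _).trans ?_
  calc ∑ k, hnorm (coord p k • w k) ≤ ∑ _k : Fin n ⊕ Fin n, hnorm p * B := by
        refine Finset.sum_le_sum fun k _ => ?_
        rw [hnorm_smul]
        exact mul_le_mul (abs_coord_le p k) (hB k) (hnorm_nonneg _) (hnorm_nonneg _)
    _ = 2 * n * B * hnorm p := by
        simp; ring

end frameMap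

/-- A linear symplectic automorphism of the Heisenberg group. -/
structure IsSymplectic (L : Heis n ≃L[ℝ] Heis n) : Prop where
  symp_map : ∀ p q, symp (L p) (L q) = symp p q
  vertical : ∀ p, (L p).2.2 = p.2.2

/-- The rotation by a right angle of the horizontal part. -/
def rotate (p : Heis n) : Heis n := (-p.2.1, p.1, 0)

lemma hnorm_rotate (p : Heis n) : hnorm (rotate p) = hnorm p := by
  simp [hnorm, rotate, max_comm]

/-- Quantitative non-degeneracy of the symplectic form. It replaces determinants in the proofs of
injectivity and of bounds for inverses. -/
lemma hnorm_sq_le_symp_rotate (p : Heis n) : hnorm p ^ 2 ≤ symp p (rotate p) := by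
  have : symp p (rotate p) = ‖p.1‖ ^ 2 + ‖p.2.1‖ ^ 2 := by
    simp [symp, rotate]
  rw [this]
  rcases max_choice ‖p.1‖ ‖p.2.1‖ with h | h <;> rw [hnorm, h] <;> nlinarith [sq_nonneg ‖p.1‖,
    sq_nonneg ‖p.2.1‖]

lemma IsSymplectic.symm {L : Heis n ≃L[ℝ] Heis n} (hL : IsSymplectic L) : IsSymplectic L.symm where
  symp_map p q := by
    rw [← hL.symp_map, L.apply_symm_apply, L.apply_symm_apply]
  vertical p := by
    rw [← hL.vertical, L.apply_symm_apply]

/-- Symplectic duality: pairing `L⁻¹ v` with its own rotation equals pairing `v` with the image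
under `L` of that rotation, so a bound on `L` bounds `L⁻¹`. The factor 2 comes from `abs_symp_le`.
-/
lemma IsSymplectic.hnorm_symm_le {L : Heis n ≃L[ℝ] Heis n} (hL : IsSymplectic L) {K : ℝ}
    (hK : ∀ p, hnorm (L p) ≤ K * hnorm p) (v : Heis n) :
    hnorm (L.symm v) ≤ 2 * K * hnorm v := by
  set p := L.symm v with hp
  rcases (hnorm_nonneg p).eq_or_lt with h | h
  · have hv : v = L p := by simp [hp]
    have h1 := hK p
    rw [← h, ← hv, MulZeroClass.mul_zero] at h1
    rw [← h, le_antisymm h1 (hnorm_nonneg v), MulZeroClass.mul_zero]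
  · refine le_of_mul_le_mul_right ?_ h
    calc hnorm p * hnorm p ≤ symp p (rotate p) := by
          rw [← sq]; exact hnorm_sq_le_symp_rotate p
      _ = symp v (L (rotate p)) := by rw [← hL.symp_map, hp, L.apply_symm_apply]
      _ ≤ 2 * (hnorm v * hnorm (L (rotate p))) := (le_abs_self _).trans (abs_symp_le _ _)
      _ ≤ 2 * (hnorm v * (K * hnorm p)) := by
          have := hK (rotate p)
          rw [hnorm_rotate] at this
          exact mul_le_mul_of_nonneg_left (mul_le_mul_of_nonneg_left this (hnorm_nonneg v))
            zero_le_two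
      _ = 2 * K * hnorm v * hnorm p := by ring

/-- The vertical line is the kernel of the symplectic product, hence preserved. Together with
`vertical` this makes `L` a group automorphism. -/
lemma IsSymplectic.map_vertical {L : Heis n ≃L[ℝ] Heis n} (hL : IsSymplectic L) (t : ℝ) :
    (L ((0, 0, t) : Heis n)).1 = 0 ∧ (L ((0, 0, t) : Heis n)).2.1 = 0 := by
  have h1 : hnorm (L ((0, 0, t) : Heis n)) ^ 2 ≤ 0 := by
    refine (hnorm_sq_le_symp_rotate _).trans (le_of_eq ?_)
    rw [← L.apply_symm_apply (rotate _), hL.symp_map]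
    simp [symp]
  have h2 : hnorm (L ((0, 0, t) : Heis n)) = 0 := by
    nlinarith [sq_nonneg (hnorm (L ((0, 0, t) : Heis n)))]
  exact ⟨norm_le_zero_iff.1 ((le_max_left _ _).trans h2.le),
    norm_le_zero_iff.1 ((le_max_right _ _).trans h2.le)⟩

lemma IsSymplectic.map_mul {L : Heis n ≃L[ℝ] Heis n} (hL : IsSymplectic L) (p q : Heis n) :
    L (mul p q) = mul (L p) (L q) := by
  have e : ∀ p q : Heis n, mul p q = p + q + ((0, 0, (1 / 2) * symp p q) : Heis n) := by
    intro p q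
    simp [mul_def, Prod.ext_iff]
  have hT : ∀ t : ℝ, L ((0, 0, t) : Heis n) = (0, 0, t) := fun t =>
    Prod.ext (hL.map_vertical t).1 (Prod.ext (hL.map_vertical t).2 (hL.vertical (0, 0, t)))
  rw [e, e, map_add, map_add, hT, hL.symp_map]

lemma IsSymplectic.gauge_le {L : Heis n ≃L[ℝ] Heis n} (hL : IsSymplectic L) {K : ℝ}
    (hK1 : 1 ≤ K) (hK : ∀ p, hnorm (L p) ≤ K * hnorm p) (p : Heis n) :
    gauge (L p) ≤ K * gauge p := by
  have hg := gauge_nonneg p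
  refine gauge_le_of (by positivity) ((hK p).trans ?_) ?_
  · exact mul_le_mul_of_nonneg_left (hnorm_le_gauge p) (by linarith)
  · rw [hL.vertical]
    refine (abs_le_gauge_sq p).trans (pow_le_pow_left₀ hg ?_ 2)
    exact le_mul_of_one_le_left hg hK1

lemma IsSymplectic.gaugeDist_le {L : Heis n ≃L[ℝ] Heis n} (hL : IsSymplectic L) {K : ℝ}
    (hK1 : 1 ≤ K) (hK : ∀ p, hnorm (L p) ≤ K * hnorm p) (p q : Heis n) :
    gaugeDist (L p) (L q) ≤ K * gaugeDist p q := by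
  have : mul (inv (L p)) (L q) = L (mul (inv p) q) := by
    rw [hL.map_mul]; simp [inv]
  rw [gaugeDist, this]
  exact hL.gauge_le hK1 hK _

lemma frame_coord (k l : Fin n ⊕ Fin n) : coord (frame k 0) l = if k = l then 1 else 0 := by
  rcases k with i | i <;> rcases l with j | j <;>
    simp [coord, frame, horizontalField, eq_comm]

/-- Symplectic bases of the horizontal space correspond to symplectic automorphisms. -/
lemma exists_isSymplectic {w : Fin n ⊕ Fin n → Heis n}
    (hw : ∀ k l, symp (w k) (w l) = sympMatrix k l) (hv : ∀ k, (w k).2.2 = 0) {B : ℝ}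
    (hB : ∀ k, hnorm (w k) ≤ B) :
    ∃ L : Heis n ≃L[ℝ] Heis n, IsSymplectic L ∧ (∀ k, L (frame k 0) = w k) ∧
      L (reeb 0) = reeb 0 ∧ (∀ p, hnorm (L p) ≤ 2 * n * B * hnorm p) := by
  -- A kernel element is symplectically orthogonal to its own rotation, so its horizontal part
  -- vanishes; its height is preserved by the map.
  have hinj : Function.Injective (frameMap w) := by
    rw [← LinearMap.ker_eq_bot, LinearMap.ker_eq_bot']
    intro p hp
    have h1 := (hnorm_sq_le_symp_rotate p).trans (symp_frameMap hw p (rotate p)).symm.le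
    rw [hp] at h1
    have h2 : symp 0 (frameMap w (rotate p)) = 0 := by simp [symp]
    have h3 : hnorm p = 0 := by
      rw [h2] at h1; nlinarith [sq_nonneg (hnorm p)]
    have h4 := frameMap_vertical hv p
    rw [hp] at h4
    have a1 := (le_max_left _ _).trans h3.le
    have a2 := (le_max_right _ _).trans h3.le
    ext1
    · simpa using a1
    ext1
    · simpa using a2
    · exact h4.symm
  let L : Heis n ≃L[ℝ] Heis n := (LinearEquiv.ofInjectiveEndo _ hinj).toContinuousLinearEquiv
  have hL : ∀ p, L p = frameMap w p := fun p => rfl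
  refine ⟨L, ⟨fun p q => symp_frameMap hw p q, fun p => frameMap_vertical hv p⟩, fun k => ?_, ?_,
    fun p => hnorm_frameMap_le hB p⟩
  · rw [hL, frameMap_apply]
    have : (frame k (0 : Heis n)).2.2 = 0 := by
      rcases k with i | i <;> simp [frame, horizontalField]
    simp [frame_coord, this]
  · rw [hL, frameMap_apply]
    have : ∀ k, coord (reeb (0 : Heis n)) k = 0 := by
      rintro (i | i) <;> simp [coord, reeb]
    simp [this]
    simp [reeb]

end Heis

/-! ### Affine contact automorphisms and iterated horizontal derivatives. -/

namespace Heis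

variable {n : ℕ}

/-- The linear part of the left translation by `a`. -/
def shear (a : Heis n) : Heis n ≃L[ℝ] Heis n :=
  LinearEquiv.toContinuousLinearEquiv
    { toFun := fun p => (p.1, p.2.1, p.2.2 + (1 / 2) * symp a p)
      map_add' := fun p q => by
        simp only [symp_add_right, Prod.fst_add, Prod.snd_add, Prod.mk_add_mk]
        refine Prod.ext rfl (Prod.ext rfl ?_)
        simp only []; ring
      map_smul' := fun c p => by
        simp only [symp_smul_right, Prod.smul_fst, Prod.smul_snd, RingHom.id_apply, Prod.smul_mk,
          smul_eq_mul]
        refine Prod.ext rfl (Prod.ext rfl ?_)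
        simp only []; ring
      invFun := fun p => (p.1, p.2.1, p.2.2 - (1 / 2) * symp a p)
      left_inv := fun p => by simp [symp]
      right_inv := fun p => by simp [symp] }

lemma shear_apply (a p : Heis n) : shear a p = (p.1, p.2.1, p.2.2 + (1 / 2) * symp a p) := rfl

lemma mul_eq_add_shear (a p : Heis n) : mul a p = a + shear a p := by
  rw [mul_def, shear_apply]
  refine Prod.ext rfl (Prod.ext rfl ?_)
  simp only [Prod.snd_add]; ring

lemma contactForm_mul_shear (a p v : Heis n) :
    contactForm (mul a p) (shear a v) = contactForm p v := by
  have h1 : ∀ q, symp q (shear a v) = symp q v := fun q => symp_congr rfl rfl rfl rfl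
  have h2 : symp (mul a p) v = symp a v + symp p v := by
    rw [← symp_add_left]; exact symp_congr rfl rfl rfl rfl
  rw [contactForm_apply, contactForm_apply, h1, h2, shear_apply]
  simp only []; ring

lemma IsSymplectic.contactForm_map {L : Heis n ≃L[ℝ] Heis n} (hL : IsSymplectic L) (p v : Heis n) :
    contactForm (L p) (L v) = contactForm p v := by
  rw [contactForm_apply, contactForm_apply, hL.symp_map, hL.vertical]

/-- The action of a linear map of the Heisenberg group on horizontal directions. -/
def planar (L : Heis n ≃L[ℝ] Heis n) (w : EuclideanSpace ℝ (Fin n) × EuclideanSpace ℝ (Fin n)) :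
    EuclideanSpace ℝ (Fin n) × EuclideanSpace ℝ (Fin n) :=
  ((L (w.1, w.2, 0)).1, (L (w.1, w.2, 0)).2.1)

lemma eq_horizontalField_of_contactForm_eq_zero {p v : Heis n} (h : contactForm p v = 0) :
    v = horizontalField (v.1, v.2.1) p := by
  rw [contactForm_apply] at h
  refine Prod.ext rfl (Prod.ext rfl ?_)
  rw [horizontalField_def]
  have : symp p (v.1, v.2.1, 0) = symp p v := symp_congr rfl rfl rfl rfl
  simp only [this]; linarith

/-- Contact automorphisms map left-invariant horizontal fields to left-invariant horizontal
fields. -/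
lemma IsSymplectic.shear_map_horizontalField {L : Heis n ≃L[ℝ] Heis n} (hL : IsSymplectic L)
    (a p : Heis n) (w : EuclideanSpace ℝ (Fin n) × EuclideanSpace ℝ (Fin n)) :
    shear a (L (horizontalField w p)) = horizontalField (planar L w) (mul a (L p)) := by
  have h0 : contactForm (mul a (L p)) (shear a (L (horizontalField w p))) = 0 := by
    rw [contactForm_mul_shear, hL.contactForm_map, contactForm_horizontalField]
  rw [eq_horizontalField_of_contactForm_eq_zero h0]
  congr 1
  have h1 : horizontalField w p = (w.1, w.2, 0) + (0, 0, (1 / 2) * symp p (w.1, w.2, 0)) := by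
    simp [horizontalField_def]
  obtain ⟨e1, e2⟩ := hL.map_vertical ((1 / 2) * symp p (w.1, w.2, 0))
  rw [shear_apply, h1, map_add]
  simp only [Prod.fst_add, Prod.snd_add, e1, e2, add_zero, planar]

/-- Precomposition with an affine isomorphism commutes with `fderiv` even where the derivative does
not exist, so no regularity of `F` is needed. -/
lemma horizontalDeriv_comp_affine {L : Heis n ≃L[ℝ] Heis n} (hL : IsSymplectic L) (a : Heis n)
    (F : Heis n → Heis n) (ws : List (EuclideanSpace ℝ (Fin n) × EuclideanSpace ℝ (Fin n))) :
    horizontalDeriv ws (fun p => F (mul a (L p))) =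
      fun p => horizontalDeriv (ws.map (planar L)) F (mul a (L p)) := by
  induction ws with
  | nil => rfl
  | cons w ws ih =>
    funext p
    simp only [horizontalDeriv, List.map_cons, ih]
    set g := horizontalDeriv (ws.map (planar L)) F
    have e : (fun p => g (mul a (L p))) = (fun x => g (a + x)) ∘ (L.trans (shear a)) := by
      funext p; simp [mul_eq_add_shear]
    rw [e, ContinuousLinearEquiv.comp_right_fderiv, fderiv_comp_add_left,
      ContinuousLinearMap.comp_apply]
    simp only [ContinuousLinearEquiv.coe_coe, ContinuousLinearEquiv.trans_apply]
    rw [hL.shear_map_horizontalField, mul_eq_add_shear]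

/-- The list is non-empty so that at least one derivative removes the constant `c`; order zero has
to be estimated separately. -/
lemma horizontalDeriv_affine_comp (c : Heis n) (T : Heis n ≃L[ℝ] Heis n) (F : Heis n → Heis n)
    (w : EuclideanSpace ℝ (Fin n) × EuclideanSpace ℝ (Fin n))
    (ws : List (EuclideanSpace ℝ (Fin n) × EuclideanSpace ℝ (Fin n))) :
    horizontalDeriv (w :: ws) (fun p => c + T (F p)) =
      fun p => T (horizontalDeriv (w :: ws) F p) := by
  induction ws generalizing w with
  | nil =>
    funext p
    have e : (fun p => T (F p)) = T ∘ F := rfl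
    simp only [horizontalDeriv, fderiv_const_add]
    rw [e, ContinuousLinearEquiv.comp_fderiv]
    rfl
  | cons w' ws ih =>
    funext p
    have e : (fun p => T (horizontalDeriv (w' :: ws) F p)) = T ∘ horizontalDeriv (w' :: ws) F := rfl
    rw [horizontalDeriv, ih]
    beta_reduce
    rw [e, ContinuousLinearEquiv.comp_fderiv]
    rfl

lemma horizontalField_smul (c : ℝ) (w : EuclideanSpace ℝ (Fin n) × EuclideanSpace ℝ (Fin n))
    (p : Heis n) : horizontalField (c • w) p = c • horizontalField w p := by
  simp [horizontalField, inner_smul_right]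
  ring

lemma horizontalDeriv_map_smul (F : Heis n → Heis n)
    (l : List (ℝ × (EuclideanSpace ℝ (Fin n) × EuclideanSpace ℝ (Fin n)))) :
    horizontalDeriv (l.map fun x => x.1 • x.2) F =
      (l.map Prod.fst).prod • horizontalDeriv (l.map Prod.snd) F := by
  induction l with
  | nil => simp [horizontalDeriv]
  | cons x l ih =>
    funext p
    simp only [List.map_cons, horizontalDeriv, ih, List.prod_cons]
    rw [fderiv_const_smul_field, horizontalField_smul]
    simp only [map_smul, Pi.smul_apply, smul_apply, mul_smul]

lemma norm_le_euclNorm (v : Heis n) : ‖v‖ ≤ euclNorm v := by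
  unfold euclNorm
  refine max_le (Real.le_sqrt_of_sq_le ?_) (max_le (Real.le_sqrt_of_sq_le ?_)
    (Real.le_sqrt_of_sq_le ?_))
  · nlinarith [sq_nonneg ‖v.2.1‖, sq_nonneg v.2.2]
  · nlinarith [sq_nonneg ‖v.1‖, sq_nonneg v.2.2]
  · rw [Real.norm_eq_abs, sq_abs]; nlinarith [sq_nonneg ‖v.2.1‖, sq_nonneg ‖v.1‖]

lemma euclNorm_le_norm (v : Heis n) : euclNorm v ≤ 2 * ‖v‖ := by
  unfold euclNorm
  rw [Real.sqrt_le_left (by positivity)]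
  have h1 := pow_le_pow_left₀ (norm_nonneg _) (norm_fst_le v) 2
  have h2 := pow_le_pow_left₀ (norm_nonneg _) ((norm_fst_le v.2).trans (norm_snd_le v)) 2
  have h3 := pow_le_pow_left₀ (norm_nonneg _) ((norm_snd_le v.2).trans (norm_snd_le v)) 2
  rw [Real.norm_eq_abs, sq_abs] at h3
  nlinarith [sq_nonneg ‖v‖]

lemma euclNorm_smul (c : ℝ) (v : Heis n) : euclNorm (c • v) = |c| * euclNorm v := by
  unfold euclNorm
  rw [← Real.sqrt_sq_eq_abs, ← Real.sqrt_mul (sq_nonneg c)]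
  congr 1
  simp only [Prod.smul_fst, Prod.smul_snd, norm_smul, smul_eq_mul, mul_pow, Real.norm_eq_abs,
    sq_abs]
  ring

lemma exists_unit_smul (hn : 1 ≤ n) (w : EuclideanSpace ℝ (Fin n) × EuclideanSpace ℝ (Fin n)) :
    ∃ u : EuclideanSpace ℝ (Fin n) × EuclideanSpace ℝ (Fin n), ‖u.1‖ ^ 2 + ‖u.2‖ ^ 2 = 1 ∧
      Real.sqrt (‖w.1‖ ^ 2 + ‖w.2‖ ^ 2) • u = w := by
  set c := Real.sqrt (‖w.1‖ ^ 2 + ‖w.2‖ ^ 2) with hc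
  have hc2 : c ^ 2 = ‖w.1‖ ^ 2 + ‖w.2‖ ^ 2 := Real.sq_sqrt (by positivity)
  rcases eq_or_ne c 0 with h | h
  -- For `w = 0` any unit vector works, and `n ≥ 1` provides one.
  · refine ⟨(EuclideanSpace.single ⟨0, hn⟩ 1, 0), by simp, ?_⟩
    rw [h] at hc2 ⊢
    have h1 : ‖w.1‖ = 0 := by nlinarith [sq_nonneg ‖w.1‖, sq_nonneg ‖w.2‖]
    have h2 : ‖w.2‖ = 0 := by nlinarith [sq_nonneg ‖w.1‖, sq_nonneg ‖w.2‖]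
    rw [zero_smul]
    exact (Prod.ext (norm_eq_zero.1 h1) (norm_eq_zero.1 h2)).symm
  · refine ⟨c⁻¹ • w, ?_, smul_inv_smul₀ h w⟩
    simp only [Prod.smul_fst, Prod.smul_snd, norm_smul, mul_pow]
    rw [← mul_add, ← hc2, norm_inv, Real.norm_eq_abs, inv_pow, sq_abs]
    field_simp

/-- A bound on derivatives along unit horizontal fields gives a bound on derivatives along
horizontal fields of length at most `B`. -/
lemma euclNorm_horizontalDeriv_le (hn : 1 ≤ n) {F : Heis n → Heis n} {p : Heis n} {k : ℕ}
    {B C : ℝ} (hB : 1 ≤ B)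
    (hC : ∀ ws : List (EuclideanSpace ℝ (Fin n) × EuclideanSpace ℝ (Fin n)), ws.length ≤ k →
      (∀ v ∈ ws, ‖v.1‖ ^ 2 + ‖v.2‖ ^ 2 = 1) → euclNorm (horizontalDeriv ws F p) ≤ C)
    (ws : List (EuclideanSpace ℝ (Fin n) × EuclideanSpace ℝ (Fin n))) (hws : ws.length ≤ k)
    (hwB : ∀ v ∈ ws, Real.sqrt (‖v.1‖ ^ 2 + ‖v.2‖ ^ 2) ≤ B) :
    euclNorm (horizontalDeriv ws F p) ≤ B ^ k * C := by
  choose u hu1 hu2 using exists_unit_smul (n := n) hn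
  set l := ws.map fun w => (Real.sqrt (‖w.1‖ ^ 2 + ‖w.2‖ ^ 2), u w) with hl
  have e : ws = l.map fun x => x.1 • x.2 := by
    rw [hl, List.map_map]
    conv_lhs => rw [← List.map_id ws]
    exact List.map_congr_left fun w _ => (hu2 w).symm
  have hprod : ∀ ws : List (EuclideanSpace ℝ (Fin n) × EuclideanSpace ℝ (Fin n)),
      (∀ v ∈ ws, Real.sqrt (‖v.1‖ ^ 2 + ‖v.2‖ ^ 2) ≤ B) →
      |(ws.map fun w => Real.sqrt (‖w.1‖ ^ 2 + ‖w.2‖ ^ 2)).prod| ≤ B ^ ws.length := by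
    intro ws
    induction ws with
    | nil => simp
    | cons w ws ih =>
      intro h
      rw [List.map_cons, List.prod_cons, abs_mul, List.length_cons, pow_succ' B,
        abs_of_nonneg (Real.sqrt_nonneg _)]
      exact mul_le_mul (h w (by simp)) (ih fun v hv => h v (by simp [hv])) (abs_nonneg _)
        (by linarith)
  have hb : euclNorm (horizontalDeriv (l.map Prod.snd) F p) ≤ C := by
    refine hC _ (by simpa [hl] using hws) fun v hv => ?_
    simp only [hl, List.map_map, List.mem_map] at hv
    obtain ⟨w, _, rfl⟩ := hv
    exact hu1 w
  rw [e, horizontalDeriv_map_smul, Pi.smul_apply, euclNorm_smul]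
  have e2 : l.map Prod.fst = ws.map fun w => Real.sqrt (‖w.1‖ ^ 2 + ‖w.2‖ ^ 2) := by
    rw [hl, List.map_map]; rfl
  rw [e2]
  refine mul_le_mul ((hprod ws hwB).trans (pow_le_pow_right₀ hB hws)) hb (Real.sqrt_nonneg _) ?_
  positivity

lemma norm_shear_le (a v : Heis n) : ‖shear a v‖ ≤ (1 + hnorm a) * ‖v‖ := by
  have hh : hnorm v ≤ ‖v‖ := max_le (norm_fst_le v) ((norm_fst_le v.2).trans (norm_snd_le v))
  have ha := hnorm_nonneg a
  have h0 : ‖v‖ ≤ (1 + hnorm a) * ‖v‖ := le_mul_of_one_le_left (norm_nonneg v) (by linarith)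
  rw [shear_apply]
  refine max_le ((norm_fst_le v).trans h0)
    (max_le (((norm_fst_le v.2).trans (norm_snd_le v)).trans h0) ?_)
  have h1 : |v.2.2| ≤ ‖v‖ := (norm_snd_le v.2).trans (norm_snd_le v)
  have h2 := abs_symp_le a v
  have h3 : hnorm a * hnorm v ≤ hnorm a * ‖v‖ := mul_le_mul_of_nonneg_left hh ha
  refine (abs_add_le _ _).trans ?_
  rw [abs_mul, abs_of_nonneg (by norm_num : (0 : ℝ) ≤ 1 / 2)]
  linarith

lemma IsSymplectic.norm_le {L : Heis n ≃L[ℝ] Heis n} (hL : IsSymplectic L) {K : ℝ}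
    (hK1 : 1 ≤ K) (hK : ∀ p, hnorm (L p) ≤ K * hnorm p) (v : Heis n) : ‖L v‖ ≤ K * ‖v‖ := by
  have hh : hnorm v ≤ ‖v‖ := max_le (norm_fst_le v) ((norm_fst_le v.2).trans (norm_snd_le v))
  have h1 : hnorm (L v) ≤ K * ‖v‖ := (hK v).trans (mul_le_mul_of_nonneg_left hh (by linarith))
  refine max_le ((le_max_left _ _).trans h1) (max_le ((le_max_right _ _).trans h1) ?_)
  rw [hL.vertical]
  exact ((norm_snd_le v.2).trans (norm_snd_le v)).trans (le_mul_of_one_le_left (norm_nonneg v) hK1)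

lemma norm_le_gauge (p : Heis n) : ‖p‖ ≤ gauge p + gauge p ^ 2 := by
  have h0 := gauge_nonneg p
  have h1 := hnorm_le_gauge p
  refine max_le (((le_max_left _ _).trans h1).trans ?_)
    (max_le (((le_max_right _ _).trans h1).trans ?_) ((abs_le_gauge_sq p).trans ?_)) <;>
    nlinarith [sq_nonneg (gauge p)]

end Heis

/-! ### Recentred charts. -/

section Recenter

variable {n : ℕ} {E : Type*} [NormedAddCommGroup E] [NormedSpace ℝ E]
  {M : Type*} [TopologicalSpace M] [ChartedSpace E M]

lemma Heis.contDiff_mul_left (p : Heis n) : ContDiff ℝ ∞ (Heis.mul p) := by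
  have : Heis.mul p = fun x => p + Heis.shear p x := funext (Heis.mul_eq_add_shear p)
  rw [this]
  exact contDiff_const.add (Heis.shear p).contDiff

namespace PartialDiffeomorph

/-- The chart `φ` precomposed with the contact automorphism `x ↦ p · L x` and restricted to `U`. -/
def recenter (φ : PartialDiffeomorph 𝓘(ℝ, Heis n) 𝓘(ℝ, E) (Heis n) M ∞) (p : Heis n)
    (L : Heis n ≃L[ℝ] Heis n) (U : Set (Heis n)) (hU : IsOpen U)
    (hUφ : ∀ x ∈ U, Heis.mul p (L x) ∈ φ.source) :
    PartialDiffeomorph 𝓘(ℝ, Heis n) 𝓘(ℝ, E) (Heis n) M ∞ where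
  toFun x := φ (Heis.mul p (L x))
  invFun y := L.symm (Heis.mul (Heis.inv p) (φ.symm y))
  source := U
  target := φ.target ∩ (fun y => L.symm (Heis.mul (Heis.inv p) (φ.symm y))) ⁻¹' U
  map_source' x hx := by
    refine ⟨φ.map_source (hUφ x hx), ?_⟩
    rw [mem_preimage, φ.symm_apply_apply (hUφ x hx), Heis.inv_mul_cancel_left,
      L.symm_apply_apply]
    exact hx
  map_target' y hy := hy.2
  left_inv' x hx := by
    rw [φ.symm_apply_apply (hUφ x hx), Heis.inv_mul_cancel_left, L.symm_apply_apply]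
  right_inv' y hy := by
    rw [L.apply_symm_apply, Heis.mul_inv_cancel_left]
    exact φ.apply_symm_apply hy.1
  open_source := hU
  open_target := by
    refine ContinuousOn.isOpen_inter_preimage ?_ φ.open_target hU
    have h : Continuous fun x => L.symm (Heis.mul (Heis.inv p) x) :=
      L.symm.continuous.comp (Heis.contDiff_mul_left (Heis.inv p)).continuous
    exact h.comp_continuousOn φ.contMDiffOn_invFun.continuousOn
  contMDiffOn_toFun := by
    have h : ContDiff ℝ ∞ fun x => Heis.mul p (L x) :=
      (Heis.contDiff_mul_left p).comp L.contDiff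
    exact φ.contMDiffOn_toFun.comp h.contMDiff.contMDiffOn hUφ
  contMDiffOn_invFun := by
    have h : ContDiff ℝ ∞ fun x => L.symm (Heis.mul (Heis.inv p) x) :=
      L.symm.contDiff.comp (Heis.contDiff_mul_left (Heis.inv p))
    exact h.contMDiff.comp_contMDiffOn (φ.contMDiffOn_invFun.mono inter_subset_left)

variable (φ : PartialDiffeomorph 𝓘(ℝ, Heis n) 𝓘(ℝ, E) (Heis n) M ∞) {p : Heis n}
    {L : Heis n ≃L[ℝ] Heis n}

lemma mfderiv_comp_affine {x : Heis n} (hx : Heis.mul p (L x) ∈ φ.source) (v : Heis n) :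
    (mfderiv 𝓘(ℝ, Heis n) 𝓘(ℝ, E) (fun x => φ (Heis.mul p (L x))) x v : E) =
      mfderiv 𝓘(ℝ, Heis n) 𝓘(ℝ, E) φ (Heis.mul p (L x)) (Heis.shear p (L v)) := by
  have h : HasFDerivAt (fun x => Heis.mul p (L x))
      ((L.trans (Heis.shear p) : Heis n ≃L[ℝ] Heis n) : Heis n →L[ℝ] Heis n) x := by
    have e : (fun x => Heis.mul p (L x)) = fun x => p + (L.trans (Heis.shear p)) x :=
      funext fun x => Heis.mul_eq_add_shear p (L x)
    rw [e]
    exact (L.trans (Heis.shear p)).hasFDerivAt.const_add p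
  have h2 := (HasMFDerivAt.comp x (φ.mdifferentiableAt (by simp) hx).hasMFDerivAt
    h.hasMFDerivAt).mfderiv
  exact congrArg (fun T : Heis n →L[ℝ] E => T v) h2

lemma bijective_mfderiv {p : Heis n} (hp : p ∈ φ.source) :
    Function.Bijective (mfderiv 𝓘(ℝ, Heis n) 𝓘(ℝ, E) φ p) := by
  refine ⟨fun u v huv => ?_, fun u => ?_⟩
  · have h1 := φ.mfderiv_symm_mfderiv hp u
    have h2 := φ.mfderiv_symm_mfderiv hp v
    rw [← h1, ← h2]
    exact congrArg (mfderiv 𝓘(ℝ, E) 𝓘(ℝ, Heis n) φ.symm (φ p)) huv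
  · have h := φ.mfderiv_mfderiv_symm (φ.map_source hp) u
    rw [φ.symm_apply_apply hp] at h
    exact ⟨_, h⟩

lemma IsContact.recenter {φ : PartialDiffeomorph 𝓘(ℝ, Heis n) 𝓘(ℝ, E) (Heis n) M ∞}
    {θ : ∀ x : M, TangentSpace 𝓘(ℝ, E) x →L[ℝ] ℝ} (hφ : φ.IsContact θ) (hL : Heis.IsSymplectic L)
    {U : Set (Heis n)} (hU : IsOpen U) (hUφ : ∀ x ∈ U, Heis.mul p (L x) ∈ φ.source) :
    (φ.recenter p L U hU hUφ).IsContact θ := by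
  intro x hx v
  refine (congrArg (θ (φ (Heis.mul p (L x)))) (φ.mfderiv_comp_affine (hUφ x hx) v)).trans ?_
  rw [hφ _ (hUφ x hx), Heis.contactForm_mul_shear, hL.contactForm_map]

end PartialDiffeomorph

end Recenter

/-! ### Orthonormal symplectic bases and the differential at the unit. -/

lemma formD_neg_right {E : Type*} [NormedAddCommGroup E] [NormedSpace ℝ E]
    {M : Type*} [TopologicalSpace M] [ChartedSpace E M]
    (θ : ∀ x : M, TangentSpace 𝓘(ℝ, E) x →L[ℝ] ℝ) (x : M) (u v : TangentSpace 𝓘(ℝ, E) x) :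
    formD θ x u (-v) = -formD θ x u v := by
  let c : TangentSpace 𝓘(ℝ, E) x → E := fun w =>
    mfderiv 𝓘(ℝ, E) 𝓘(ℝ, E) (extChartAt 𝓘(ℝ, E) x) x w
  let D : E →L[ℝ] E →L[ℝ] ℝ := fderiv ℝ (formInChart θ x) (extChartAt 𝓘(ℝ, E) x x)
  have hc : c (-v) = -c v :=
    (mfderiv 𝓘(ℝ, E) 𝓘(ℝ, E) (extChartAt 𝓘(ℝ, E) x) x).map_neg v
  have h : ∀ w, formD θ x u w = D (c u) (c w) - D (c w) (c u) := fun w => rfl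
  rw [h, h, hc, map_neg, map_neg, neg_apply]
  ring

namespace ContactSubRiemannian

variable {n : ℕ} {E : Type*} [NormedAddCommGroup E] [NormedSpace ℝ E]
  {M : Type*} [TopologicalSpace M] [ChartedSpace E M] [IsManifold 𝓘(ℝ, E) ∞ M]
  {S : ContactSubRiemannian (E := E) M}
  {φ : PartialDiffeomorph 𝓘(ℝ, Heis n) 𝓘(ℝ, E) (Heis n) M ∞}

namespace IsOrthonormalSymplecticBasis

variable {x : M} {W : Fin n ⊕ Fin n → TangentSpace 𝓘(ℝ, E) x}

lemma J_inr (hW : S.IsOrthonormalSymplecticBasis x W) (i : Fin n) :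
    S.J x (W (Sum.inr i)) = W (Sum.inl i) := by
  rw [hW.symplectic, map_neg, S.J_sq x _ (hW.horizontal _), neg_neg]

lemma J_inl (hW : S.IsOrthonormalSymplecticBasis x W) (i : Fin n) :
    S.J x (W (Sum.inl i)) = -W (Sum.inr i) := by
  rw [hW.symplectic, neg_neg]

/-- Orthonormality fixes `dθ(W_k, J W_l)`, and `J` permutes the basis up to sign. The minus sign
here cancels the one in `IsContact.formD_eq`. -/
lemma formD_eq (hW : S.IsOrthonormalSymplecticBasis x W) (k l : Fin n ⊕ Fin n) :
    formD S.θ x (W k) (W l) = -Heis.sympMatrix k l := by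
  have h : ∀ k l, formD S.θ x (W k) (S.J x (W l)) = if k = l then 1 else 0 := by
    intro k l
    have := hW.orthonormal k l
    rwa [metric, hW.horizontal, MulZeroClass.zero_mul, zero_add] at this
  rcases l with j | j
  · rw [← hW.J_inr j, h]
    rcases k with i | i <;> simp [Heis.sympMatrix, neg_ite]
  · rw [hW.symplectic, formD_neg_right, h]
    rcases k with i | i <;> simp [Heis.sympMatrix]

end IsOrthonormalSymplecticBasis

/-- An orthonormal symplectic basis is the image of the standard frame under the differential of
the chart precomposed with a suitable contact automorphism. -/
lemma exists_isSymplectic_of_basis (hφ : φ.IsContact S.θ) {p : Heis n} (hp : p ∈ φ.source) {K : ℝ}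
    (hK : 0 ≤ K) (hlow : ∀ q ∈ φ.source, ENNReal.ofReal (Heis.gaugeDist p q) ≤
      ENNReal.ofReal K * S.subDist (φ p) (φ q))
    {W : Fin n ⊕ Fin n → TangentSpace 𝓘(ℝ, E) (φ p)}
    (hW : S.IsOrthonormalSymplecticBasis (φ p) W) :
    ∃ L : Heis n ≃L[ℝ] Heis n, Heis.IsSymplectic L ∧
      (∀ k, mfderiv 𝓘(ℝ, Heis n) 𝓘(ℝ, E) φ p (Heis.shear p (L (Heis.frame k 0))) = W k) ∧
      L (Heis.reeb 0) = Heis.reeb 0 ∧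
      (∀ x, Heis.hnorm (L x) ≤ 2 * n * K * Heis.hnorm x) := by
  have hx : φ p ∈ φ.target := φ.map_source hp
  set w : Fin n ⊕ Fin n → Heis n := fun k =>
    mfderiv 𝓘(ℝ, E) 𝓘(ℝ, Heis n) φ.symm (φ p) (W k) with hw
  have hWw : ∀ k, mfderiv 𝓘(ℝ, Heis n) 𝓘(ℝ, E) φ p (w k) = W k := by
    intro k
    have h := φ.mfderiv_mfderiv_symm hx (W k)
    rw [φ.symm_apply_apply hp] at h
    exact h
  have hwc : ∀ k, Heis.contactForm p (w k) = 0 := by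
    intro k
    have h := hφ.form_eq hx (W k)
    rw [hW.horizontal, φ.symm_apply_apply hp] at h
    exact h.symm
  have hwh : ∀ k, w k = Heis.horizontalField ((w k).1, (w k).2.1) p := fun k =>
    Heis.eq_horizontalField_of_contactForm_eq_zero (hwc k)
  -- Left translation back to `e` only kills the vertical component of a horizontal vector at `p`;
  -- `shear p` restores it.
  set w' : Fin n ⊕ Fin n → Heis n := fun k => ((w k).1, (w k).2.1, 0) with hw'
  have hww' : ∀ k, Heis.shear p (w' k) = w k := by
    intro k
    conv_rhs => rw [hwh k]
    rw [Heis.shear_apply, Heis.horizontalField_def]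
    simp [hw']
  have hsymp : ∀ k l, Heis.symp (w' k) (w' l) = Heis.sympMatrix k l := by
    intro k l
    have h := hφ.formD_eq hx (W k) (W l)
    rw [hW.formD_eq] at h
    rw [neg_inj.1 h]
    exact Heis.symp_congr rfl rfl rfl rfl
  -- The `W k` are unit vectors, so the lower Lipschitz constant bounds their preimages.
  have hB : ∀ k, Heis.hnorm (w' k) ≤ K := by
    intro k
    have h := hnorm_le_of_gaugeDist_le hφ hp hK hlow ((w k).1, (w k).2.1)
    rw [← hwh, hWw, hW.orthonormal, if_pos rfl, Real.sqrt_one, mul_one] at h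
    exact h
  obtain ⟨L, hL, h1, h2, h3⟩ := Heis.exists_isSymplectic hsymp (fun k => rfl) hB
  refine ⟨L, hL, fun k => ?_, h2, h3⟩
  rw [h1, hww', hWw]

/-- The Reeb vector is determined by the contact form, so every contact chart maps `T` to it without
any adaptation to `W`. -/
lemma isReebVector_mfderiv (hφ : φ.IsContact S.θ) (h0 : (0 : Heis n) ∈ φ.source) :
    S.IsReebVector (φ 0) (mfderiv 𝓘(ℝ, Heis n) 𝓘(ℝ, E) φ 0 (Heis.reeb 0)) := by
  refine ⟨?_, fun v => ?_⟩
  · rw [hφ 0 h0, Heis.contactForm_apply]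
    simp [Heis.reeb, Heis.symp]
  · rw [hφ.formD_eq (φ.map_source h0)]
    have h := φ.mfderiv_symm_mfderiv h0 (Heis.reeb 0)
    refine (congrArg (fun u => -Heis.symp u _) h).trans ?_
    simp [Heis.reeb, Heis.symp]

lemma pullbackJ_add (q u v : Heis n) :
    S.pullbackJ φ q (u + v) = S.pullbackJ φ q u + S.pullbackJ φ q v := by
  unfold pullbackJ
  have h1 := (mfderiv 𝓘(ℝ, Heis n) 𝓘(ℝ, E) φ q).map_add u v
  have h2 := (S.J (φ q)).map_add (mfderiv 𝓘(ℝ, Heis n) 𝓘(ℝ, E) φ q u)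
    (mfderiv 𝓘(ℝ, Heis n) 𝓘(ℝ, E) φ q v)
  have h3 := (mfderiv 𝓘(ℝ, E) 𝓘(ℝ, Heis n) φ.symm (φ q)).map_add
    (S.J (φ q) (mfderiv 𝓘(ℝ, Heis n) 𝓘(ℝ, E) φ q u))
    (S.J (φ q) (mfderiv 𝓘(ℝ, Heis n) 𝓘(ℝ, E) φ q v))
  exact (congrArg _ ((congrArg _ h1).trans h2)).trans h3

lemma pullbackJ_frame_inl (h0 : (0 : Heis n) ∈ φ.source)
    {W : Fin n ⊕ Fin n → TangentSpace 𝓘(ℝ, E) (φ 0)}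
    (hW : S.IsOrthonormalSymplecticBasis (φ 0) W)
    (hD : ∀ k, mfderiv 𝓘(ℝ, Heis n) 𝓘(ℝ, E) φ 0 (Heis.frame k 0) = W k) (i : Fin n) :
    S.pullbackJ φ 0 (Heis.frame (Sum.inl i) 0) = -Heis.frame (Sum.inr i) 0 := by
  unfold pullbackJ
  rw [hD, hW.J_inl, map_neg, ← hD]
  exact congrArg Neg.neg (φ.mfderiv_symm_mfderiv h0 _)

lemma pullbackJ_frame_inr (h0 : (0 : Heis n) ∈ φ.source)
    {W : Fin n ⊕ Fin n → TangentSpace 𝓘(ℝ, E) (φ 0)}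
    (hW : S.IsOrthonormalSymplecticBasis (φ 0) W)
    (hD : ∀ k, mfderiv 𝓘(ℝ, Heis n) 𝓘(ℝ, E) φ 0 (Heis.frame k 0) = W k) (i : Fin n) :
    S.pullbackJ φ 0 (Heis.frame (Sum.inr i) 0) = Heis.frame (Sum.inl i) 0 := by
  unfold pullbackJ
  rw [hD, hW.J_inr, ← hD]
  exact φ.mfderiv_symm_mfderiv h0 _

lemma pullbackJ_reeb (hφ : φ.IsContact S.θ) (h0 : (0 : Heis n) ∈ φ.source) :
    S.pullbackJ φ 0 (Heis.reeb 0) = Heis.reeb 0 := by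
  obtain ⟨h1, h2⟩ := isReebVector_mfderiv hφ h0
  unfold pullbackJ
  rw [S.J_reeb _ _ h1 h2]
  exact φ.mfderiv_symm_mfderiv h0 _

/-- At `e` the pulled-back `J` acts on the frame by `X_i ↦ -Y_i`, `Y_i ↦ X_i`, `T ↦ T`. Expanding
`v` in this frame gives minus the horizontal scalar product. -/
lemma symp_pullbackJ (hφ : φ.IsContact S.θ) (h0 : (0 : Heis n) ∈ φ.source)
    {W : Fin n ⊕ Fin n → TangentSpace 𝓘(ℝ, E) (φ 0)}
    (hW : S.IsOrthonormalSymplecticBasis (φ 0) W)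
    (hD : ∀ k, mfderiv 𝓘(ℝ, Heis n) 𝓘(ℝ, E) φ 0 (Heis.frame k 0) = W k) (u v : Heis n) :
    Heis.symp u (S.pullbackJ φ 0 v) = -(inner ℝ u.1 v.1 + inner ℝ u.2.1 v.2.1) := by
  let P : Heis n →ₗ[ℝ] Heis n :=
    { toFun := S.pullbackJ φ 0
      map_add' := pullbackJ_add 0
      map_smul' := fun c v => S.pullbackJ_smul 0 v c }
  have hP : S.pullbackJ φ 0 v = P v := rfl
  have hv : v = Heis.frameMap (fun k => Heis.frame k 0) v := by
    rw [Heis.frameMap_apply]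
    ext i
    · simp [Fintype.sum_sum_type, Heis.frame, Heis.horizontalField, Heis.coord, Prod.fst_sum,
        Finset.sum_apply, Pi.single_apply]
    · simp [Fintype.sum_sum_type, Heis.frame, Heis.horizontalField, Heis.coord, Prod.fst_sum,
        Prod.snd_sum, Finset.sum_apply, Pi.single_apply]
    · simp [Fintype.sum_sum_type, Heis.frame, Heis.horizontalField, Heis.coord, Prod.snd_sum]
  have hPl : ∀ i, P (Heis.frame (Sum.inl i) 0) = -Heis.frame (Sum.inr i) 0 :=
    pullbackJ_frame_inl h0 hW hD
  have hPr : ∀ i, P (Heis.frame (Sum.inr i) 0) = Heis.frame (Sum.inl i) 0 :=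
    pullbackJ_frame_inr h0 hW hD
  have hPt : P ((0, 0, 1) : Heis n) = (0, 0, 1) := pullbackJ_reeb hφ h0
  have hl : ∀ i, Heis.symp u (Heis.frame (Sum.inl i) 0) = -u.2.1 i := by
    intro i
    simp [Heis.symp, Heis.frame, Heis.horizontalField, EuclideanSpace.inner_single_right]
  have hr : ∀ i, Heis.symp u (Heis.frame (Sum.inr i) 0) = u.1 i := by
    intro i
    simp [Heis.symp, Heis.frame, Heis.horizontalField, EuclideanSpace.inner_single_right]
  have ht : Heis.symp u (0, 0, 1) = 0 := by simp [Heis.symp]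
  have hPv : P v = ∑ k, Heis.coord v k • P (Heis.frame k 0) + v.2.2 • P (0, 0, 1) := by
    conv_lhs => rw [hv, Heis.frameMap_apply]
    simp only [map_add, map_sum, map_smul]
  rw [hP, hPv, ← Heis.sympForm_apply]
  simp only [map_add, map_sum, map_smul, Fintype.sum_sum_type, hPl, hPr, hPt, map_neg,
    Heis.sympForm_apply, hl, hr, ht, Heis.coord, Sum.elim_inl, Sum.elim_inr, smul_eq_mul,
    PiLp.inner_apply]
  simp [mul_comm]
  ring

lemma isOrthogonalMap_mfderiv (hφ : φ.IsContact S.θ) (h0 : (0 : Heis n) ∈ φ.source)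
    {W : Fin n ⊕ Fin n → TangentSpace 𝓘(ℝ, E) (φ 0)}
    (hW : S.IsOrthonormalSymplecticBasis (φ 0) W)
    (hD : ∀ k, mfderiv 𝓘(ℝ, Heis n) 𝓘(ℝ, E) φ 0 (Heis.frame k 0) = W k) :
    S.IsOrthogonalMap (φ 0) (mfderiv 𝓘(ℝ, Heis n) 𝓘(ℝ, E) φ 0) := by
  refine ⟨φ.bijective_mfderiv h0, fun u v => ?_⟩
  have h1 := symp_pullbackJ hφ h0 hW hD u v
  have h2 := φ.mfderiv_symm_mfderiv h0 u
  have h3 : formD S.θ (φ 0) (mfderiv 𝓘(ℝ, Heis n) 𝓘(ℝ, E) φ 0 u)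
      (S.J (φ 0) (mfderiv 𝓘(ℝ, Heis n) 𝓘(ℝ, E) φ 0 v)) =
      -Heis.symp u (S.pullbackJ φ 0 v) := by
    rw [hφ.formD_eq (φ.map_source h0)]
    exact congrArg (fun u => -Heis.symp u _) h2
  refine (congrArg₂ (fun a b : ℝ => a + b) (congrArg₂ (fun a b : ℝ => a * b) (hφ 0 h0 u)
    (hφ 0 h0 v)) h3).trans ?_
  rw [h1, Heis.metric]
  ring

/-- The base point is a variable `a` with `ψ 0 = a`, so that the transport in `differentialAtUnit`
disappears by substitution. -/
lemma differentialAtUnit_spec {ψ : PartialDiffeomorph 𝓘(ℝ, Heis n) 𝓘(ℝ, E) (Heis n) M ∞}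
    (hψ : ψ.IsContact S.θ) (h0 : (0 : Heis n) ∈ ψ.source) {a : M} (h : ψ 0 = a)
    {W : Fin n ⊕ Fin n → TangentSpace 𝓘(ℝ, E) a} (hW : S.IsOrthonormalSymplecticBasis a W)
    (hD : ∀ k, (mfderiv 𝓘(ℝ, Heis n) 𝓘(ℝ, E) ψ 0 (Heis.frame k 0) : E) = W k) :
    (∀ j, differentialAtUnit (E := E) ψ a h (Heis.frame j 0) = W j) ∧
      S.IsReebVector a (differentialAtUnit (E := E) ψ a h (Heis.reeb 0)) ∧
      S.IsOrthogonalMap a (differentialAtUnit (E := E) ψ a h) := by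
  subst h
  exact ⟨hD, isReebVector_mfderiv hψ h0, isOrthogonalMap_mfderiv hψ h0 hW hD⟩

end ContactSubRiemannian

/-! ### Gauge balls and uniformly controlled adapted coordinates. -/

namespace Heis

variable {n : ℕ} {d : Heis n → Heis n → ℝ≥0∞}

lemma GaugeComparable.gauge_lt_of_mem_ball (hd : GaugeComparable d) {s : ℝ} {x : Heis n}
    (hx : x ∈ ball d s) : gauge x < 10 * s := by
  have hs : 0 < s := ENNReal.ofReal_pos.1 (bot_le.trans_lt hx)
  have h := (hd 0 x).2
  rw [gaugeDist_zero_left] at h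
  have h2 : 10 * d 0 x < 10 * ENNReal.ofReal s :=
    (ENNReal.mul_lt_mul_iff_right (by norm_num) (by norm_num)).2 hx
  have h3 := h.trans_lt h2
  rw [show (10 : ℝ≥0∞) = ENNReal.ofReal 10 by norm_num, ← ENNReal.ofReal_mul (by norm_num)] at h3
  exact (ENNReal.ofReal_lt_ofReal_iff (by positivity)).1 h3

lemma GaugeComparable.mem_ball_of_gauge_lt (hd : GaugeComparable d) {s : ℝ} {x : Heis n}
    (hx : 10 * gauge x < s) : x ∈ ball d s := by
  have h := (hd 0 x).1
  rw [gaugeDist_zero_left] at h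
  have h0 := gauge_nonneg x
  exact h.trans_lt ((ENNReal.ofReal_lt_ofReal_iff (by linarith)).2 hx)

end Heis

namespace ContactSubRiemannian

variable {n : ℕ} {E : Type*} [NormedAddCommGroup E] [NormedSpace ℝ E]
  {M : Type*} [TopologicalSpace M] [ChartedSpace E M] [IsManifold 𝓘(ℝ, E) ∞ M]
  {S : ContactSubRiemannian (E := E) M} {d₀ d : Heis n → Heis n → ℝ≥0∞} {k : ℕ} {R r C : ℝ}
  {φ : M → PartialDiffeomorph 𝓘(ℝ, Heis n) 𝓘(ℝ, E) (Heis n) M ∞}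

namespace IsBoundedAtlas

lemma isContact (hφ : S.IsBoundedAtlas d₀ d k R r C φ) (a : M) : (φ a).IsContact S.θ := by
  intro p hp v
  exact hφ.contact a p (by rwa [← hφ.source_eq a]) v

lemma subDist_le (hφ : S.IsBoundedAtlas d₀ d k R r C φ) (hC : 0 ≤ C) (hd : Heis.GaugeComparable d)
    (a : M) {p q : Heis n} (hp : p ∈ Heis.ball d₀ R) (hq : q ∈ Heis.ball d₀ R) :
    S.subDist (φ a p) (φ a q) ≤ ENNReal.ofReal (10 * C * Heis.gaugeDist p q) := by
  refine (hφ.bilipschitz a p hp q hq).2.trans ((mul_le_mul_right (hd p q).1 _).trans ?_)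
  rw [← ENNReal.ofReal_mul hC]
  exact ENNReal.ofReal_le_ofReal (by ring_nf; rfl)

lemma gaugeDist_le (hφ : S.IsBoundedAtlas d₀ d k R r C φ) (hC : 0 < C) (hd : Heis.GaugeComparable d)
    (a : M) {p q : Heis n} (hp : p ∈ Heis.ball d₀ R) (hq : q ∈ Heis.ball d₀ R) :
    ENNReal.ofReal (Heis.gaugeDist p q) ≤ ENNReal.ofReal (10 * C) * S.subDist (φ a p) (φ a q) := by
  have h := (hφ.bilipschitz a p hp q hq).1
  rw [ENNReal.inv_mul_le_iff (ENNReal.ofReal_pos.2 hC).ne' ENNReal.ofReal_ne_top] at h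
  refine (hd p q).2.trans ((mul_le_mul_right h 10).trans (le_of_eq ?_))
  rw [← _root_.mul_assoc, ENNReal.ofReal_mul (by norm_num)]
  norm_num

/-- Every point has a linear symplectic change of coordinates, with controlled norms, after which
the translated chart around it is adapted to a given orthonormal symplectic basis. -/
lemma exists_adapted (hφ : S.IsBoundedAtlas d₀ d k R r C φ) (hr : 0 < r) (hC : 0 < C)
    (hd : Heis.GaugeComparable d) (hS : S.IsMetricComplete) (a : M)
    {W : Fin n ⊕ Fin n → TangentSpace 𝓘(ℝ, E) a} (hW : S.IsOrthonormalSymplecticBasis a W) {K : ℝ}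
    (hK : K = 1 + 4 * n * (10 * C)) :
    ∃ p ∈ Heis.ball d₀ R, φ a p = a ∧ ∃ L : Heis n ≃L[ℝ] Heis n, Heis.IsSymplectic L ∧
      (∀ x, Heis.hnorm (L x) ≤ K * Heis.hnorm x) ∧
      (∀ x, Heis.hnorm (L.symm x) ≤ K * Heis.hnorm x) ∧
      (∀ j, (mfderiv 𝓘(ℝ, Heis n) 𝓘(ℝ, E) (φ a) p (Heis.shear p (L (Heis.frame j 0))) : E)
        = W j) ∧
      ∀ x, 10 * C * (K * Heis.gauge x) < r → Heis.mul p (L x) ∈ Heis.ball d₀ R := by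
  have hball := hφ.ball_subset a
  have ha : a ∈ {b | S.subDist a b < ENNReal.ofReal r} := by
    rw [mem_ofPred_eq, subDist_self]; exact ENNReal.ofReal_pos.2 hr
  obtain ⟨p, hp, hpa⟩ := hball ha
  have hK0 : (0 : ℝ) ≤ 10 * C := by positivity
  have hn0 : (0 : ℝ) ≤ n := Nat.cast_nonneg n
  have hnK : 0 ≤ n * (10 * C) := by positivity
  have hsrc := hφ.source_eq a
  have hps : p ∈ (φ a).source := by rw [hsrc]; exact hp
  have hL : ∃ L : Heis n ≃L[ℝ] Heis n, Heis.IsSymplectic L ∧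
      (∀ j, (mfderiv 𝓘(ℝ, Heis n) 𝓘(ℝ, E) (φ a) p (Heis.shear p (L (Heis.frame j 0))) : E)
        = W j) ∧ (∀ x, Heis.hnorm (L x) ≤ 2 * n * (10 * C) * Heis.hnorm x) := by
    -- Abstracting the basis lets `φ a p` be rewritten as `a` in its type.
    have key := fun W' => exists_isSymplectic_of_basis (W := W') (hφ.isContact a) hps hK0
      (fun q hq => hφ.gaugeDist_le hC hd a hp (by rwa [← hsrc]))
    rw [hpa] at key
    obtain ⟨L, hL, h1, -, h3⟩ := key W hW
    exact ⟨L, hL, h1, h3⟩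
  obtain ⟨L, hL, h1, h3⟩ := hL
  -- In `K = 1 + 4n(10C)`, the norm of `L` is at most `2n · 10C`, that of its inverse at most twice
  -- this, and the summand 1 gives `K ≥ 1`.
  have hLK : ∀ x, Heis.hnorm (L x) ≤ K * Heis.hnorm x := fun x =>
    (h3 x).trans (mul_le_mul_of_nonneg_right (by linarith) (Heis.hnorm_nonneg x))
  refine ⟨p, hp, hpa, L, hL, hLK, fun x => ?_, h1, fun x hx => ?_⟩
  · refine (hL.hnorm_symm_le h3 x).trans
      (mul_le_mul_of_nonneg_right (by linarith) (Heis.hnorm_nonneg x))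
  · have hopen : IsOpen (Heis.ball d₀ R) := hsrc ▸ (φ a).open_source
    refine mem_of_gaugeDist_lt hS hopen hK0 (φ := φ a) (r := r) (p := p)
      (fun p hp q hq => hφ.subDist_le hC.le hd a hp hq)
      (fun p hp q hq => hφ.gaugeDist_le hC hd a hp hq) hp ?_ ?_
    · rw [hpa]; exact hball
    · refine lt_of_le_of_lt (mul_le_mul_of_nonneg_left ?_ hK0) hx
      rw [Heis.gaugeDist, Heis.inv_mul_cancel_left]
      exact hL.gauge_le (by linarith) hLK x

end IsBoundedAtlas

end ContactSubRiemannian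

/-! ### Derivative bounds after contact changes of coordinates. -/

namespace Heis

variable {n : ℕ}

lemma sqrt_planar_le {L : Heis n ≃L[ℝ] Heis n} {K : ℝ} (hK0 : 0 ≤ K)
    (hK : ∀ x, hnorm (L x) ≤ K * hnorm x)
    {w : EuclideanSpace ℝ (Fin n) × EuclideanSpace ℝ (Fin n)} (hw : ‖w.1‖ ^ 2 + ‖w.2‖ ^ 2 = 1) :
    Real.sqrt (‖(planar L w).1‖ ^ 2 + ‖(planar L w).2‖ ^ 2) ≤ 2 * K := by
  rw [Real.sqrt_le_left (by positivity)]
  have h1 : hnorm (w.1, w.2, (0 : ℝ)) ≤ 1 := by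
    refine max_le ?_ ?_
    · exact abs_le_one_iff_mul_self_le_one.2 (by nlinarith [sq_nonneg ‖w.2‖]) |>.trans' (le_abs_self _)
    · exact abs_le_one_iff_mul_self_le_one.2 (by nlinarith [sq_nonneg ‖w.1‖]) |>.trans' (le_abs_self _)
  have h2 : hnorm (L (w.1, w.2, 0)) ≤ K := (hK _).trans (mul_le_of_le_one_right hK0 h1)
  have h3 := pow_le_pow_left₀ (norm_nonneg _) ((le_max_left _ _).trans h2) 2
  have h4 := pow_le_pow_left₀ (norm_nonneg _) ((le_max_right _ _).trans h2) 2
  unfold planar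
  nlinarith [sq_nonneg K]

/-- Derivatives of a map after contact changes of coordinates in the source and in the target. -/
lemma euclNorm_horizontalDeriv_conj_le (hn : 1 ≤ n) {F : Heis n → Heis n} {k : ℕ} {K C : ℝ}
    (hK1 : 1 ≤ K) {p q : Heis n} {L T : Heis n ≃L[ℝ] Heis n} (hL : IsSymplectic L)
    (hT : IsSymplectic T) (hLK : ∀ x, hnorm (L x) ≤ K * hnorm x)
    (hTK : ∀ x, hnorm (T x) ≤ K * hnorm x) (hq : hnorm q ≤ 10) {x : Heis n}
    (hF : ∀ ws : List (EuclideanSpace ℝ (Fin n) × EuclideanSpace ℝ (Fin n)), ws.length ≤ k →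
      (∀ v ∈ ws, ‖v.1‖ ^ 2 + ‖v.2‖ ^ 2 = 1) →
      euclNorm (horizontalDeriv ws F (mul p (L x))) ≤ C)
    (w : EuclideanSpace ℝ (Fin n) × EuclideanSpace ℝ (Fin n))
    (ws : List (EuclideanSpace ℝ (Fin n) × EuclideanSpace ℝ (Fin n)))
    (hk : (w :: ws).length ≤ k) (hw : ∀ v ∈ w :: ws, ‖v.1‖ ^ 2 + ‖v.2‖ ^ 2 = 1) :
    euclNorm (horizontalDeriv (w :: ws) (fun y => T (mul q (F (mul p (L y))))) x) ≤
      22 * K * ((2 * K) ^ k * C) := by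
  have e : (fun y => T (mul q (F (mul p (L y))))) =
      fun y => T q + ((shear q).trans T) (F (mul p (L y))) := by
    funext y
    rw [mul_eq_add_shear q, map_add]; rfl
  rw [e, horizontalDeriv_affine_comp (T q) ((shear q).trans T) (fun y => F (mul p (L y))),
    horizontalDeriv_comp_affine hL]
  beta_reduce
  set v := horizontalDeriv ((w :: ws).map (planar L)) F (mul p (L x)) with hv
  have hb : euclNorm v ≤ (2 * K) ^ k * C := by
    refine euclNorm_horizontalDeriv_le hn (by linarith) hF _ (by simpa using hk) fun u hu => ?_
    obtain ⟨u', hu', rfl⟩ := List.mem_map.1 hu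
    exact sqrt_planar_le (by linarith) hLK (hw u' hu')
  -- Here `11 = 1 + 10` from `hnorm q ≤ 10`. Passing from the sup norm to the Euclidean norm doubles
  -- it, which gives the constant 22.
  have h1 : ‖shear q v‖ ≤ 11 * ‖v‖ :=
    (norm_shear_le q v).trans (mul_le_mul_of_nonneg_right (by linarith) (norm_nonneg v))
  have h2 : ‖((shear q).trans T) v‖ ≤ K * (11 * ‖v‖) :=
    (hT.norm_le hK1 hTK (shear q v)).trans (mul_le_mul_of_nonneg_left h1 (by linarith))
  calc _ ≤ 2 * ‖((shear q).trans T) v‖ := euclNorm_le_norm _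
    _ ≤ 2 * (K * (11 * ‖v‖)) := by linarith
    _ ≤ 2 * (K * (11 * ((2 * K) ^ k * C))) := by
        have := (norm_le_euclNorm v).trans hb
        have hK0 : 0 ≤ K := by linarith
        gcongr
    _ = _ := by ring

end Heis

end

/-! ### Choice of the constants and assembly of the atlas. -/

theorem theorem3p10
    (n : ℕ) (hn : 1 ≤ n) (k : ℕ)
    (d₀ d : Heis n → Heis n → ℝ≥0∞)
    (hd₀ : d₀ ∈ Heis.standardDistances n) (hd : d ∈ Heis.standardDistances n)
    (r C : ℝ) (hr : 0 < r) (hC : 0 < C) :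
    ∃ r' μ C' : ℝ, 0 < r' ∧ r' < r ∧ 0 < μ ∧ μ ≤ 1 ∧ 0 < C' ∧
      ∀ (M : Type*) [TopologicalSpace M] [ChartedSpace (EuclideanSpace ℝ (Fin (2 * n + 1))) M]
        [IsManifold 𝓘(ℝ, EuclideanSpace ℝ (Fin (2 * n + 1))) ∞ M]
        [T2Space M] [SecondCountableTopology M] [ConnectedSpace M]
        (S : ContactSubRiemannian (E := EuclideanSpace ℝ (Fin (2 * n + 1))) M),
        S.IsMetricComplete →
        (∃ φ, S.IsBoundedAtlas d₀ d k 1 r C φ) →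
        ∀ W : ∀ a : M, Fin n ⊕ Fin n →
            TangentSpace 𝓘(ℝ, EuclideanSpace ℝ (Fin (2 * n + 1))) a,
          (∀ a, S.IsOrthonormalSymplecticBasis a (W a)) →
          ∃ ψ : M → PartialDiffeomorph 𝓘(ℝ, Heis n)
              𝓘(ℝ, EuclideanSpace ℝ (Fin (2 * n + 1))) (Heis n) M ∞,
            S.IsBoundedAtlas d₀ d k μ r' C' ψ ∧
            ∀ a, ∃ h : ψ a 0 = a,
              let D := ContactSubRiemannian.differentialAtUnit
                (E := EuclideanSpace ℝ (Fin (2 * n + 1))) (ψ a) a h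
              (∀ j, D (Heis.frame j 0) = W a j) ∧
              S.IsReebVector a (D (Heis.reeb 0)) ∧
              S.IsOrthogonalMap a D := by
  have hg₀ := Heis.gaugeComparable_of_mem_standardDistances hn hd₀
  have hg := Heis.gaugeComparable_of_mem_standardDistances hn hd
  obtain ⟨K, hK⟩ : ∃ K : ℝ, K = 1 + 4 * n * (10 * C) := ⟨_, rfl⟩
  have hK1 : 1 ≤ K := by
    have : (0 : ℝ) ≤ 4 * n * (10 * C) := by positivity
    linarith
  have hK0 : 0 < K := by linarith
  -- `N` collects the comparison constant 10 of a distance with the gauge, the Lipschitz constant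
  -- `10 C` of the charts in the gauge, and the bound `K` for `L` and its inverse. Then `N μ ≤ r`
  -- keeps the recentred ball in the chart domain and `N r' ≤ μ` yields the ball covering.
  obtain ⟨N, hN⟩ : ∃ N : ℝ, N = 10 * (10 * C * K) := ⟨_, rfl⟩
  have hN0 : 0 < N := by rw [hN]; positivity
  obtain ⟨μ, hμ⟩ : ∃ μ : ℝ, μ = min 1 (r / N) := ⟨_, rfl⟩
  have hμ0 : 0 < μ := by rw [hμ]; exact lt_min one_pos (by positivity)
  have hμ1 : μ ≤ 1 := by rw [hμ]; exact min_le_left _ _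
  have hμr : N * μ ≤ r := by
    have : μ ≤ r / N := by rw [hμ]; exact min_le_right _ _
    rw [le_div_iff₀ hN0] at this
    linarith
  obtain ⟨r', hr'⟩ : ∃ r' : ℝ, r' = min (r / 2) (μ / N) := ⟨_, rfl⟩
  have hr'0 : 0 < r' := by rw [hr']; exact lt_min (by positivity) (by positivity)
  have hr'r : r' < r := by
    have : r' ≤ r / 2 := by rw [hr']; exact min_le_left _ _
    linarith
  have hr'μ : N * r' ≤ μ := by
    have : r' ≤ μ / N := by rw [hr']; exact min_le_right _ _
    rw [le_div_iff₀ hN0] at this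
    linarith
  -- The summands serve the bi-Lipschitz condition, the derivatives of positive order, and order
  -- zero respectively.
  obtain ⟨C', hC'⟩ : ∃ C' : ℝ, C' = N + 22 * K * ((2 * K) ^ k * C) + 220 := ⟨_, rfl⟩
  have hDer0 : 0 < 22 * K * ((2 * K) ^ k * C) := by positivity
  have hC'0 : 0 < C' := by linarith
  refine ⟨r', μ, C', hr'0, hr'r, hμ0, hμ1, hC'0, ?_⟩
  intro M _ _ _ _ _ _ S hS ⟨φ, hφ⟩ W hW
  choose p hp hpa L hL hLK hLsK hframe hdom using
    fun a => hφ.exists_adapted hr hC hg hS a (hW a) hK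
  have hUφ : ∀ a, ∀ x ∈ Heis.ball d₀ μ, Heis.mul (p a) (L a x) ∈ Heis.ball d₀ 1 := by
    intro a x hx
    refine hdom a x (lt_of_lt_of_le ?_ hμr)
    have h1 := hg₀.gauge_lt_of_mem_ball hx
    have h2 : 10 * C * K * Heis.gauge x < 10 * C * K * (10 * μ) :=
      mul_lt_mul_of_pos_left h1 (by positivity)
    rw [hN]; linarith
  have hUφs : ∀ a, ∀ x ∈ Heis.ball d₀ μ, Heis.mul (p a) (L a x) ∈ (φ a).source := by
    intro a x hx
    rw [hφ.source_eq]; exact hUφ a x hx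
  have hopen := Heis.isOpen_ball hn hd₀ μ
  let ψ := fun a => (φ a).recenter (p a) (L a) (Heis.ball d₀ μ) hopen (hUφs a)
  have hψ : ∀ a x, ψ a x = φ a (Heis.mul (p a) (L a x)) := fun a x => rfl
  have hcontact : ∀ a, (ψ a).IsContact S.θ := fun a =>
    (hφ.isContact a).recenter (hL a) hopen (hUφs a)
  have h0 : (0 : Heis n) ∈ Heis.ball d₀ μ :=
    hg₀.mem_ball_of_gauge_lt (by rw [Heis.gauge_zero]; linarith)
  have hNC' : ENNReal.ofReal N ≤ ENNReal.ofReal C' := ENNReal.ofReal_le_ofReal (by linarith)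
  refine ⟨ψ, ⟨fun a => rfl, fun a x hx v => hcontact a x hx v, ?_, ?_, ?_⟩, ?_⟩
  · intro a b hb
    have hbr : b ∈ {b | S.subDist a b < ENNReal.ofReal r} :=
      lt_of_lt_of_le hb (ENNReal.ofReal_le_ofReal hr'r.le)
    obtain ⟨q, hq, rfl⟩ := hφ.ball_subset a hbr
    have h1 := hφ.gaugeDist_le hC hg a (hp a) hq
    rw [hpa] at h1
    have h2 : ENNReal.ofReal (10 * C) * S.subDist a (φ a q) <
        ENNReal.ofReal (10 * C) * ENNReal.ofReal r' :=
      (ENNReal.mul_lt_mul_iff_right (ENNReal.ofReal_pos.2 (by positivity)).ne'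
        ENNReal.ofReal_ne_top).2 hb
    have h3 := h1.trans_lt h2
    rw [← ENNReal.ofReal_mul (by positivity), ENNReal.ofReal_lt_ofReal_iff (by positivity)] at h3
    refine ⟨(L a).symm (Heis.mul (Heis.inv (p a)) q), hg₀.mem_ball_of_gauge_lt ?_, ?_⟩
    · have h4 := (hL a).symm.gauge_le hK1 (hLsK a) (Heis.mul (Heis.inv (p a)) q)
      have h5 : K * Heis.gauge (Heis.mul (Heis.inv (p a)) q) < K * (10 * C * r') :=
        mul_lt_mul_of_pos_left h3 hK0
      rw [hN] at hr'μ
      linarith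
    · rw [hψ, (L a).apply_symm_apply, Heis.mul_inv_cancel_left]
  · intro a x hx y hy
    have hx' := hUφ a x hx
    have hy' := hUφ a y hy
    have hgd : Heis.gaugeDist (Heis.mul (p a) (L a x)) (Heis.mul (p a) (L a y)) ≤
        K * Heis.gaugeDist x y := by
      rw [Heis.gaugeDist_mul_left]; exact (hL a).gaugeDist_le hK1 (hLK a) x y
    have hgd' : Heis.gaugeDist x y ≤
        K * Heis.gaugeDist (Heis.mul (p a) (L a x)) (Heis.mul (p a) (L a y)) := by
      rw [Heis.gaugeDist_mul_left]
      simpa using (hL a).symm.gaugeDist_le hK1 (hLsK a) (L a x) (L a y)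
    constructor
    · rw [ENNReal.inv_mul_le_iff (ENNReal.ofReal_pos.2 hC'0).ne' ENNReal.ofReal_ne_top]
      refine le_trans ?_ (mul_le_mul_left hNC' _)
      calc d x y ≤ ENNReal.ofReal (10 * Heis.gaugeDist x y) := (hg x y).1
        _ ≤ ENNReal.ofReal (10 * K * Heis.gaugeDist (Heis.mul (p a) (L a x))
              (Heis.mul (p a) (L a y))) := ENNReal.ofReal_le_ofReal (by linarith)
        _ = ENNReal.ofReal (10 * K) * ENNReal.ofReal (Heis.gaugeDist (Heis.mul (p a) (L a x))
              (Heis.mul (p a) (L a y))) := ENNReal.ofReal_mul (by positivity)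
        _ ≤ ENNReal.ofReal (10 * K) * (ENNReal.ofReal (10 * C) *
              S.subDist (ψ a x) (ψ a y)) := mul_le_mul_right (hφ.gaugeDist_le hC hg a hx' hy') _
        _ = ENNReal.ofReal N * S.subDist (ψ a x) (ψ a y) := by
            rw [← _root_.mul_assoc, ← ENNReal.ofReal_mul (by positivity), hN]
            congr 2; ring
    · refine le_trans ?_ (mul_le_mul_left hNC' _)
      calc S.subDist (ψ a x) (ψ a y) ≤ ENNReal.ofReal (10 * C * Heis.gaugeDist
              (Heis.mul (p a) (L a x)) (Heis.mul (p a) (L a y))) :=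
            hφ.subDist_le hC.le hg a hx' hy'
        _ ≤ ENNReal.ofReal (10 * C * K * Heis.gaugeDist x y) := by
            refine ENNReal.ofReal_le_ofReal ?_
            have := mul_le_mul_of_nonneg_left hgd (by positivity : 0 ≤ 10 * C)
            linarith
        _ = ENNReal.ofReal (10 * C * K) * ENNReal.ofReal (Heis.gaugeDist x y) :=
            ENNReal.ofReal_mul (by positivity)
        _ ≤ ENNReal.ofReal (10 * C * K) * (10 * d x y) := mul_le_mul_right (hg x y).2 _
        _ = ENNReal.ofReal N * d x y := by
            rw [hN, mul_comm 10 (10 * C * K),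
              ENNReal.ofReal_mul (show 0 ≤ 10 * C * K by positivity), ENNReal.ofReal_ofNat]
            exact (_root_.mul_assoc _ _ _).symm
  · intro a b ws hws hw x hx hxb
    rcases ws with _ | ⟨w, ws⟩
    -- Order zero: values of the coordinate change lie in `B(e, μ)`, where the gauge is at most 10,
    -- so the sup norm is at most `10 + 100` and the Euclidean norm at most 220.
    · have h1 := hg₀.gauge_lt_of_mem_ball ((ψ b).symm_apply_mem hxb)
      have h2 := Heis.gauge_nonneg ((ψ b).symm (ψ a x))
      have h3 := Heis.norm_le_gauge ((ψ b).symm (ψ a x))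
      have h4 := Heis.euclNorm_le_norm ((ψ b).symm (ψ a x))
      have h5 : Heis.gauge ((ψ b).symm (ψ a x)) ≤ 10 := by linarith
      have h6 : Heis.gauge ((ψ b).symm (ψ a x)) ^ 2 ≤ 100 := by nlinarith
      rw [Heis.horizontalDeriv]
      linarith
    · have hq : Heis.hnorm (Heis.inv (p b)) ≤ 10 := by
        have h1 := hg₀.gauge_lt_of_mem_ball (hp b)
        have h2 := Heis.hnorm_le_gauge (p b)
        have h3 : Heis.hnorm (Heis.inv (p b)) = Heis.hnorm (p b) := by
          simp [Heis.hnorm, Heis.inv]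
        linarith
      -- The coordinate change is `x ↦ L_b⁻¹(p_b⁻¹ · F(p_a · L_a x))` with `F = φ_b⁻¹ ∘ φ_a`.
      have key := Heis.euclNorm_horizontalDeriv_conj_le hn hK1 (hL a) (hL b).symm (hLK a) (hLsK b)
        hq (fun us hus hu => hφ.deriv_bound a b us hus hu _ (hUφ a x hx) hxb.1) w ws hws hw
      refine (le_of_eq rfl).trans (key.trans (by linarith))
  · intro a
    have hψ0 : ψ a 0 = a := by
      rw [hψ, map_zero, Heis.mul_zero, hpa]
    refine ⟨hψ0, ContactSubRiemannian.differentialAtUnit_spec (hcontact a) h0 hψ0 (hW a) fun j => ?_⟩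
    refine ((φ a).mfderiv_comp_affine (hUφs a 0 h0) (Heis.frame j 0)).trans ?_
    have e : Heis.mul (p a) (L a 0) = p a := by rw [map_zero, Heis.mul_zero]
    exact (congrArg (fun q => (mfderiv 𝓘(ℝ, Heis n) 𝓘(ℝ, EuclideanSpace ℝ (Fin (2 * n + 1)))
      (φ a) q (Heis.shear (p a) (L a (Heis.frame j 0))) : EuclideanSpace ℝ (Fin (2 * n + 1)))) e).trans
      (hframe a j)
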